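/- Let $G$ be a Lie group of real dimension $2n\ge 2$ with a left-invariant Hermitian structure $(J,g)$, that is, a left-invariant integrable complex structure $J$ and a left-invariant Riemannian metric $g$ with $g(J\cdot,J\cdot)=g$. Let $\Gamma\subseteq G$ be a discrete subgroup with compact quotient $M=\Gamma\backslash G$, equipped with the induced Hermitian structure, so that $(M,J,g)$ is a Lie-Hermitian manifold covered by $(G,J,g)$. Let $\mathfrak g$ be the Lie algebra of $G$ and $\mathfrak g'=[\mathfrak g,\mathfrak g]$, and assume that the Lie algebra $\mathfrak g'+J\mathfrak g'$ is nilpotent. Let $\nabla$ be the Chern connection of $(M,J,g)$, i.e. the connection on $TM$ with $\nabla g=0$, $\nabla J=0$ whose torsion has vanishing $(1,1)$-part, and let $R(X,Y,Z,W)=g\big(\nabla_X\nabla_YZ-\nabla_Y\nabla_XZ-\nabla_{[X,Y]}Z,\;W\big)$ be its curvature, extended complex multilinearly to $TM\otimes\mathbb C$. For real numbers $(\alpha,\beta)\neq(0,0)$ and a tangent vector $X$ of type $(1,0)$ and unit length, the mixed curvature is $$\mathcal C_{\alpha,\beta}(X)=\alpha\sum_{i=1}^n R(X,\overline X,e_i,\overline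 e_i)+\beta\, \frac{R(X,\overline X,X,\overline X)}{|X|^4},$$ where $e_1,\dots,e_n$ is a unitary frame of $(1,0)$-vectors. (1) If $\mathcal C_{\alpha,\beta}$ is equal to a constant $c\in\mathbb R$ (for all unit $(1,0)$-vectors at all points of $M$), then $c=0$. (2) If $\mathcal C_{\alpha,\beta}$ vanishes identically and $\beta\neq0$, then $g$ is Chern flat, i.e. $R=0$. -/

import Mathlib

open scoped Manifold ContDiff
open Bundle VectorField

noncomputable section

/-- Over `ℝ`, `minSmoothness ℝ 3 = 3`, so a smooth Lie group has enough regularity for Mathlib's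
Lie bracket on its tangent space at the identity. -/
instance instLEInftyMinSmoothnessRealThree : ENat.LEInfty (minSmoothness ℝ 3) :=
  ⟨by simp only [minSmoothness_of_isRCLikeNormedField]; exact ENat.LEInfty.out⟩

section Hermitian

variable (E : Type*) [NormedAddCommGroup E] [NormedSpace ℝ E]
  (M : Type*) [TopologicalSpace M] [ChartedSpace E M] [IsManifold 𝓘(ℝ, E) ∞ M]

/-- A Hermitian structure `(J, g)` on a smooth manifold `M`: a smooth Riemannian metric `g` and a
smooth field `J` of endomorphisms of the tangent spaces with `J² = -1`, integrable (its Nijenhuis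
tensor vanishes), and such that `g(Ju, Jv) = g(u, v)`. -/
structure HermitianStructure where
  /-- the Riemannian metric -/
  metric : ContMDiffRiemannianMetric 𝓘(ℝ, E) ∞ E (fun x : M ↦ TangentSpace 𝓘(ℝ, E) x)
  /-- the complex structure -/
  J : ∀ x : M, TangentSpace 𝓘(ℝ, E) x →L[ℝ] TangentSpace 𝓘(ℝ, E) x
  contMDiff_J : ContMDiff 𝓘(ℝ, E) (𝓘(ℝ, E).prod 𝓘(ℝ, E →L[ℝ] E)) ∞
    (fun x ↦ (⟨x, J x⟩ : TotalSpace (E →L[ℝ] E)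
      (fun x : M ↦ TangentSpace 𝓘(ℝ, E) x →L[ℝ] TangentSpace 𝓘(ℝ, E) x)))
  J_J : ∀ (x : M) (u : TangentSpace 𝓘(ℝ, E) x), J x (J x u) = -u
  integrable : ∀ (x : M) (X Y : ∀ y : M, TangentSpace 𝓘(ℝ, E) y),
    MDiffAt (T% X) x → MDiffAt (T% Y) x →
    mlieBracket 𝓘(ℝ, E) X Y x
      - mlieBracket 𝓘(ℝ, E) (fun y ↦ J y (X y)) (fun y ↦ J y (Y y)) x
      + J x (mlieBracket 𝓘(ℝ, E) (fun y ↦ J y (X y)) Y x)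
      + J x (mlieBracket 𝓘(ℝ, E) X (fun y ↦ J y (Y y)) x) = 0
  metric_J : ∀ (x : M) (u v : TangentSpace 𝓘(ℝ, E) x),
    metric.inner x (J x u) (J x v) = metric.inner x u v

end Hermitian

section Chern

variable {E : Type*} [NormedAddCommGroup E] [NormedSpace ℝ E] [FiniteDimensional ℝ E]
  {M : Type*} [TopologicalSpace M] [ChartedSpace E M] [IsManifold 𝓘(ℝ, E) ∞ M]

/-- `D` is the Chern connection of the Hermitian structure `h`: it preserves the metric and the
complex structure, and the `(1,1)`-part of its torsion vanishes, that is `T(X, conj Y) = 0` for all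
`X`, `Y` of type `(1,0)`; in real terms `T(Ju, Jv) = -T(u, v)`. In Mathlib, `D Y x u` is the
covariant derivative of the field `Y` at `x` in the direction `u`. These conditions determine
`D Y x` for all fields `Y` that are differentiable at `x`. -/
structure IsChernConnection (h : HermitianStructure E M)
    (D : CovariantDerivative 𝓘(ℝ, E) E (fun x : M ↦ TangentSpace 𝓘(ℝ, E) x)) : Prop where
  metric : ∀ (x : M) (X Y : ∀ y : M, TangentSpace 𝓘(ℝ, E) y),
    MDiffAt (T% X) x → MDiffAt (T% Y) x → ∀ u : TangentSpace 𝓘(ℝ, E) x,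
    d% (fun y ↦ h.metric.inner y (X y) (Y y)) x u =
      h.metric.inner x (D X x u) (Y x) + h.metric.inner x (X x) (D Y x u)
  parallel_J : ∀ (x : M) (X : ∀ y : M, TangentSpace 𝓘(ℝ, E) y), MDiffAt (T% X) x →
    ∀ u : TangentSpace 𝓘(ℝ, E) x, D (fun y ↦ h.J y (X y)) x u = h.J x (D X x u)
  torsion_J : ∀ (x : M) (u v : TangentSpace 𝓘(ℝ, E) x),
    D.torsion x (h.J x u) (h.J x v) = -D.torsion x u v

/-- `R(X, Y) Z = ∇_X ∇_Y Z - ∇_Y ∇_X Z - ∇_{[X, Y]} Z` for vector fields `X`, `Y`, `Z`. -/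
def curvatureOfFields
    (D : CovariantDerivative 𝓘(ℝ, E) E (fun x : M ↦ TangentSpace 𝓘(ℝ, E) x))
    (X Y Z : ∀ y : M, TangentSpace 𝓘(ℝ, E) y) (x : M) : TangentSpace 𝓘(ℝ, E) x :=
  D (fun y ↦ D Z y (Y y)) x (X x) - D (fun y ↦ D Z y (X y)) x (Y x)
    - D Z x (mlieBracket 𝓘(ℝ, E) X Y x)

/-- The curvature tensor `R(u, v) w` at a point `x`, computed with extensions of the tangent
vectors `u`, `v`, `w` to vector fields that are smooth near `x`. -/
def curvatureAt
    (D : CovariantDerivative 𝓘(ℝ, E) E (fun x : M ↦ TangentSpace 𝓘(ℝ, E) x))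
    (x : M) (u v w : TangentSpace 𝓘(ℝ, E) x) : TangentSpace 𝓘(ℝ, E) x :=
  curvatureOfFields D (FiberBundle.extend E u) (FiberBundle.extend E v) (FiberBundle.extend E w) x

/-- The connection is flat: its curvature tensor vanishes identically. -/
def IsFlatConnection
    (D : CovariantDerivative 𝓘(ℝ, E) E (fun x : M ↦ TangentSpace 𝓘(ℝ, E) x)) : Prop :=
  ∀ (x : M) (u v w : TangentSpace 𝓘(ℝ, E) x), curvatureAt D x u v w = 0

end Chern

section Complexification

variable {V : Type*} [AddCommGroup V]

/-- The vector `X` of the complexification of `V` with `X = X 0 + √-1 X 1` is represented by the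
pair of its real and imaginary parts; this is its complex conjugate. -/
def complexConj (X : Fin 2 → V) : Fin 2 → V := ![X 0, -X 1]

/-- The complex bilinear extension of a real bilinear form. -/
def complexExt₂ (B : V → V → ℝ) (X Y : Fin 2 → V) : ℂ :=
  ∑ a : Fin 2, ∑ b : Fin 2, Complex.I ^ (a.val + b.val) * (B (X a) (Y b) : ℂ)

/-- The complex multilinear extension of a real 4-linear form. -/
def complexExt₄ (R : V → V → V → V → ℝ) (X Y Z W : Fin 2 → V) : ℂ :=
  ∑ a : Fin 2, ∑ b : Fin 2, ∑ c : Fin 2, ∑ d : Fin 2,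
    Complex.I ^ (a.val + b.val + c.val + d.val) * (R (X a) (Y b) (Z c) (W d) : ℂ)

end Complexification

namespace HermitianStructure

variable {E : Type*} [NormedAddCommGroup E] [NormedSpace ℝ E] [FiniteDimensional ℝ E]
  {M : Type*} [TopologicalSpace M] [ChartedSpace E M] [IsManifold 𝓘(ℝ, E) ∞ M]

/-- `X` is a complex tangent vector of type `(1,0)`, i.e. `X = u - √-1 J u` for a real `u`. -/
def IsType10 (h : HermitianStructure E M) (x : M) (X : Fin 2 → TangentSpace 𝓘(ℝ, E) x) : Prop :=
  X 1 = -h.J x (X 0)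

/-- The complex bilinear extension of the metric to the complexified tangent space. -/
def metricC (h : HermitianStructure E M) (x : M) (X Y : Fin 2 → TangentSpace 𝓘(ℝ, E) x) : ℂ :=
  complexExt₂ (fun u v ↦ h.metric.inner x u v) X Y

/-- The complex multilinear extension of `R(u, v, w, z) = g(R(u, v) w, z)`. -/
def curvatureC (h : HermitianStructure E M)
    (D : CovariantDerivative 𝓘(ℝ, E) E (fun x : M ↦ TangentSpace 𝓘(ℝ, E) x)) (x : M)
    (X Y Z W : Fin 2 → TangentSpace 𝓘(ℝ, E) x) : ℂ :=
  complexExt₄ (fun u v w z ↦ h.metric.inner x (curvatureAt D x u v w) z) X Y Z W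

/-- `e` is a unitary frame of the `(1,0)`-tangent space at `x`, where `n` is the complex
dimension: each `e i` is of type `(1,0)` and `⟨e i, conj (e j)⟩ = δ_{ij}`. -/
def IsUnitaryFrame (h : HermitianStructure E M) (x : M) {n : ℕ}
    (e : Fin n → Fin 2 → TangentSpace 𝓘(ℝ, E) x) : Prop :=
  Module.finrank ℝ E = 2 * n ∧ (∀ i, h.IsType10 x (e i)) ∧
    ∀ i j, h.metricC x (e i) (complexConj (e j)) = if i = j then 1 else 0

/-- The first Ricci curvature `Ric(X, conj X) = ∑ i, R(X, conj X, e i, conj (e i))`, computed with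
the unitary frame `e` at `x`. -/
def ricci (h : HermitianStructure E M)
    (D : CovariantDerivative 𝓘(ℝ, E) E (fun x : M ↦ TangentSpace 𝓘(ℝ, E) x)) (x : M) {n : ℕ}
    (e : Fin n → Fin 2 → TangentSpace 𝓘(ℝ, E) x) (X : Fin 2 → TangentSpace 𝓘(ℝ, E) x) : ℂ :=
  ∑ i, h.curvatureC D x X (complexConj X) (e i) (complexConj (e i))

/-- The holomorphic sectional curvature `H(X) = R(X, conj X, X, conj X) / |X|⁴`, where
`|X|² = ⟨X, conj X⟩`. -/
def holomorphicSectional (h : HermitianStructure E M)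
    (D : CovariantDerivative 𝓘(ℝ, E) E (fun x : M ↦ TangentSpace 𝓘(ℝ, E) x)) (x : M)
    (X : Fin 2 → TangentSpace 𝓘(ℝ, E) x) : ℂ :=
  h.curvatureC D x X (complexConj X) X (complexConj X) / h.metricC x X (complexConj X) ^ 2

/-- The mixed curvature of the connection `D` is the constant `c`: for every point `x`, every
tangent vector `X` of type `(1,0)` and unit length at `x` and every unitary frame `e` at `x`,
`α Ric(X, conj X) + β H(X) = c`. -/
def HasConstantMixedCurvature (h : HermitianStructure E M)
    (D : CovariantDerivative 𝓘(ℝ, E) E (fun x : M ↦ TangentSpace 𝓘(ℝ, E) x))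
    (α β c : ℝ) : Prop :=
  ∀ (x : M) (n : ℕ) (e : Fin n → Fin 2 → TangentSpace 𝓘(ℝ, E) x), h.IsUnitaryFrame x e →
    ∀ X : Fin 2 → TangentSpace 𝓘(ℝ, E) x, h.IsType10 x X → h.metricC x X (complexConj X) = 1 →
      (α : ℂ) * h.ricci D x e X + (β : ℂ) * h.holomorphicSectional D x X = (c : ℂ)

end HermitianStructure

section LieHermitian

variable {E : Type*} [NormedAddCommGroup E] [NormedSpace ℝ E] [FiniteDimensional ℝ E]
  {G : Type*} [TopologicalSpace G] [ChartedSpace E G] [Group G] [LieGroup 𝓘(ℝ, E) ∞ G]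
  {M : Type*} [TopologicalSpace M] [ChartedSpace E M] [IsManifold 𝓘(ℝ, E) ∞ M]

/-- The Hermitian structure on the Lie group `G` is left-invariant: every left translation
preserves the metric and the complex structure. -/
structure HermitianStructure.IsLeftInvariant (h : HermitianStructure E G) : Prop where
  metric : ∀ (a x : G) (u v : TangentSpace 𝓘(ℝ, E) x),
    h.metric.inner (a * x) (mfderiv 𝓘(ℝ, E) 𝓘(ℝ, E) (fun y ↦ a * y) x u)
      (mfderiv 𝓘(ℝ, E) 𝓘(ℝ, E) (fun y ↦ a * y) x v) = h.metric.inner x u v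
  J : ∀ (a x : G) (u : TangentSpace 𝓘(ℝ, E) x),
    h.J (a * x) (mfderiv 𝓘(ℝ, E) 𝓘(ℝ, E) (fun y ↦ a * y) x u) =
      mfderiv 𝓘(ℝ, E) 𝓘(ℝ, E) (fun y ↦ a * y) x (h.J x u)

/-- `(M, hM)` is a Lie-Hermitian manifold with covering `p : G → M`, where `G` carries the
left-invariant Hermitian structure `hG`: `M` is compact, and `p` exhibits it, with its smooth
structure, metric and complex structure, as the quotient of `(G, hG)` by a discrete subgroup `Γ`
(acting by left translations, which preserve left-invariant structures). -/
structure IsLieHermitian (hG : HermitianStructure E G) (Γ : Subgroup G)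
    (hM : HermitianStructure E M) (p : G → M) : Prop where
  leftInvariant : hG.IsLeftInvariant
  discrete : DiscreteTopology Γ
  compact : CompactSpace M
  localDiffeo : IsLocalDiffeomorph 𝓘(ℝ, E) 𝓘(ℝ, E) ∞ p
  surjective : Function.Surjective p
  fiber : ∀ x y : G, p x = p y ↔ ∃ γ ∈ Γ, γ * x = y
  metric : ∀ (x : G) (u v : TangentSpace 𝓘(ℝ, E) x),
    hM.metric.inner (p x) (mfderiv 𝓘(ℝ, E) 𝓘(ℝ, E) p x u) (mfderiv 𝓘(ℝ, E) 𝓘(ℝ, E) p x v) =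
      hG.metric.inner x u v
  J : ∀ (x : G) (u : TangentSpace 𝓘(ℝ, E) x),
    hM.J (p x) (mfderiv 𝓘(ℝ, E) 𝓘(ℝ, E) p x u) = mfderiv 𝓘(ℝ, E) 𝓘(ℝ, E) p x (hG.J x u)

/-- The subspace `𝔤' + J 𝔤'` of the Lie algebra `𝔤` of `G`, where `𝔤' = [𝔤, 𝔤]`. It contains `𝔤'`,
so it is a Lie subalgebra. -/
def HermitianStructure.commutatorHull (h : HermitianStructure E G) :
    LieSubalgebra ℝ (GroupLieAlgebra 𝓘(ℝ, E) G) where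
  toSubmodule :=
    (LieAlgebra.derivedSeries ℝ (GroupLieAlgebra 𝓘(ℝ, E) G) 1).toSubmodule ⊔
      (LieAlgebra.derivedSeries ℝ (GroupLieAlgebra 𝓘(ℝ, E) G) 1).toSubmodule.map
        (h.J 1 : GroupLieAlgebra 𝓘(ℝ, E) G →ₗ[ℝ] GroupLieAlgebra 𝓘(ℝ, E) G)
  lie_mem' := by
    intro x y _ _
    refine Submodule.mem_sup_left ?_
    simp only [LieAlgebra.derivedSeriesOfIdeal_succ,
      LieAlgebra.derivedSeriesOfIdeal_zero]
    exact LieSubmodule.lie_mem_lie (LieSubmodule.mem_top x) (LieSubmodule.mem_top y)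

end LieHermitian

end

/-! Left-invariance reduces the theorem to Hermitian linear algebra on the Lie algebra. Put a_u v =
½([u, v] + J[Ju, v]). This is conjugate linear in u, integrability makes a_u commute with J, and the
Chern connection is ∇_u = a_u − a_u^*. Since [u, Ju] = 2J a_u u, the curvature satisfies R(u, Ju) =
2J(−[a_u, a_u^*] + a_w + a_w^*) with w = a_u u.

Let W = 𝔤' + J𝔤', which contains all values of a. Nilpotency of W gives a filtration of W along
which every a_w with w ∈ W moves one step. So a_w is nilpotent, hence traceless. Commutators are
traceless too, so the first Ricci curvature vanishes and the mixed curvature is β times the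
holomorphic sectional curvature H. If β = 0 then c = 0 at once.

If H is constant, its sign is tested at two vectors: it is ≤ 0 at a vector orthogonal to the image
of a, and ≥ 0 at a vector of W killed by all a_w (when W = 0, a vanishes and H = 0). So the constant
is zero (`eq_zero_of_holSec_eq`).

If H = 0, the identity is polarized and traced over W. Since an operator and its adjoint have equal
Hilbert–Schmidt norms, the traced identities leave sums of squares that must vanish. This gives
first a(W, W) = 0 (`apply_eq_zero_of_mem`), then a_w = 0 for w ∈ W (`eq_zero_of_mem`). What remains
of H = 0 says that every a_u is normal, and polarization gives [a_u, a_v^*] = 0. The Jacobi identity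
gives [a_u, a_v] = ½ a_{[u,v] − [Ju,Jv]}, which is 0 because brackets lie in W. All terms of R then
cancel (`curvature_eq_zero`).

The passage to M uses local frames of transported left-invariant fields (`LieFrame`). Uniqueness of
the algebraic Chern connection makes the coefficients of D constant in such a frame, and
tensoriality identifies `curvatureAt` with the algebraic curvature (`curvatureAt_fld`). -/

noncomputable section

/-! ### Hermitian linear algebra of a nilpotent (0,1)-part -/

section LinearAlgebra

open scoped InnerProductSpace
open LinearMap (adjoint)

/-- Moving an endomorphism across the trace of a bilinear map. -/
theorem OrthonormalBasis.sum_apply_adjoint {V A ι : Type*} [NormedAddCommGroup V]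
    [InnerProductSpace ℝ V] [FiniteDimensional ℝ V] [AddCommGroup A] [Module ℝ A] [Fintype ι]
    (b : OrthonormalBasis ι ℝ V) (S : V →ₗ[ℝ] V) (B : V →ₗ[ℝ] V →ₗ[ℝ] A) :
    ∑ i, B (b i) (adjoint S (b i)) = ∑ i, B (S (b i)) (b i) := by
  have h1 : ∀ i, B (b i) (adjoint S (b i)) = ∑ k, ⟪S (b k), b i⟫_ℝ • B (b i) (b k) := by
    intro i
    conv_lhs => rw [← b.sum_repr' (adjoint S (b i))]
    simp [LinearMap.adjoint_inner_right]
  have h2 : ∀ k, B (S (b k)) (b k) = ∑ i, ⟪S (b k), b i⟫_ℝ • B (b i) (b k) := by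
    intro k
    conv_lhs => rw [← b.sum_repr' (S (b k))]
    simp [real_inner_comm]
  simp_rw [h1, h2]
  exact Finset.sum_comm

/-- Invariance of the Hilbert–Schmidt norm under the adjoint. In the traced curvature identities it
cancels the two indefinite terms and leaves a sum of squares. -/
theorem OrthonormalBasis.sum_norm_sq_adjoint {V ι : Type*} [NormedAddCommGroup V]
    [InnerProductSpace ℝ V] [FiniteDimensional ℝ V] [Fintype ι]
    (b : OrthonormalBasis ι ℝ V) (S : V →ₗ[ℝ] V) :
    ∑ i, ‖adjoint S (b i)‖ ^ 2 = ∑ i, ‖S (b i)‖ ^ 2 := by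
  have := b.sum_apply_adjoint S ((innerₗ V).comp (adjoint S))
  simp only [LinearMap.comp_apply, innerₗ_apply_apply, LinearMap.adjoint_inner_left] at this
  simp only [← real_inner_self_eq_norm_sq]
  rw [← this]
  exact Finset.sum_congr rfl fun i _ ↦ by rw [LinearMap.adjoint_inner_left]

variable {V : Type*} [NormedAddCommGroup V] [InnerProductSpace ℝ V]

/-- The `(0,1)`-part `a u v` of the Chern connection of a left-invariant Hermitian structure: it is
conjugate linear in `u`, complex linear in `v`, takes values in a complex subspace `W`, and the
operators `a w`, `w ∈ W`, act nilpotently along a filtration `F` of `W`. -/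
structure IsNilpotentDolbeault (J : V →ₗ[ℝ] V) (a : V →ₗ[ℝ] V →ₗ[ℝ] V) (W : Submodule ℝ V)
    (F : ℕ → Submodule ℝ V) (m : ℕ) : Prop where
  J_J : ∀ u, J (J u) = -u
  inner_J : ∀ u v, ⟪J u, J v⟫_ℝ = ⟪u, v⟫_ℝ
  J_left : ∀ u v, a (J u) v = -J (a u v)
  J_right : ∀ u v, a u (J v) = J (a u v)
  J_mem : ∀ w ∈ W, J w ∈ W
  mem : ∀ u v, a u v ∈ W
  zero : F 0 = W
  last : F m = ⊥
  step : ∀ k, ∀ u ∈ W, ∀ v ∈ F k, a u v ∈ F (k + 1)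

/-- Up to a positive factor, the holomorphic sectional curvature of the Chern connection with
`(0,1)`-part `a`. -/
def holSec [FiniteDimensional ℝ V] (a : V →ₗ[ℝ] V →ₗ[ℝ] V) (u : V) : ℝ :=
  ‖adjoint (a u) u‖ ^ 2 - ‖a u u‖ ^ 2 - 2 * ⟪a (a u u) u, u⟫_ℝ

namespace IsNilpotentDolbeault

variable {J : V →ₗ[ℝ] V} {a : V →ₗ[ℝ] V →ₗ[ℝ] V} {W : Submodule ℝ V}
  {F : ℕ → Submodule ℝ V} {m : ℕ}

theorem inner_J_left (h : IsNilpotentDolbeault J a W F m) (u v : V) :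
    ⟪J u, v⟫_ℝ = -⟪u, J v⟫_ℝ := by
  have := h.inner_J u (J v)
  rw [h.J_J, inner_neg_right] at this
  linarith

/-- The last nonzero intersection of S with the filtration is sent by every a u, u ∈ W, into the
next intersection, which is zero. This plays the role of Engel's theorem. -/
theorem exists_killed (h : IsNilpotentDolbeault J a W F m) {S : Submodule ℝ V} (hSW : S ≤ W)
    (hS : S ≠ ⊥) (hinv : ∀ u ∈ W, ∀ v ∈ S, a u v ∈ S) :
    ∃ n ∈ S, n ≠ 0 ∧ ∀ u ∈ W, a u n = 0 := by
  classical
  have hex : ∃ k, S ⊓ F k = ⊥ := ⟨m, by rw [h.last, inf_bot_eq]⟩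
  obtain ⟨j, hj⟩ : ∃ j, Nat.find hex = j + 1 := by
    refine Nat.exists_eq_succ_of_ne_zero fun h0 ↦ hS ?_
    have := Nat.find_spec hex
    rwa [h0, h.zero, inf_eq_left.2 hSW] at this
  have hne : S ⊓ F j ≠ ⊥ := Nat.find_min hex (by omega)
  obtain ⟨n, hn, hn0⟩ := Submodule.exists_mem_ne_zero_of_ne_bot hne
  refine ⟨n, hn.1, hn0, fun u hu ↦ ?_⟩
  have : a u n ∈ S ⊓ F (j + 1) := ⟨hinv u hu n hn.1, h.step j u hu n hn.2⟩
  rw [← hj, Nat.find_spec hex] at this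
  simpa using this

theorem isNilpotent (h : IsNilpotentDolbeault J a W F m) {w : V} (hw : w ∈ W) :
    IsNilpotent (a w) := by
  -- The first application only brings V into W = F 0; the remaining m go down the filtration.
  refine ⟨m + 1, ?_⟩
  have : ∀ k v, (a w ^ (k + 1)) v ∈ F k := by
    intro k
    induction k with
    | zero => intro v; simpa [h.zero] using h.mem w v
    | succ k ih => intro v; rw [pow_succ', Module.End.mul_apply]; exact h.step k w hw _ (ih v)
  ext v
  simpa [h.last] using this m v

theorem trace_eq_zero (h : IsNilpotentDolbeault J a W F m) {w : V} (hw : w ∈ W) :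
    LinearMap.trace ℝ V (a w) = 0 :=
  (LinearMap.isNilpotent_trace_of_isNilpotent (h.isNilpotent hw)).eq_zero

theorem J_mem_orthogonal (h : IsNilpotentDolbeault J a W F m) {x : V} (hx : x ∈ Wᗮ) :
    J x ∈ Wᗮ := by
  refine (Submodule.mem_orthogonal' W _).2 fun w hw ↦ ?_
  rw [h.inner_J_left, (Submodule.mem_orthogonal' W _).1 hx _ (h.J_mem w hw), neg_zero]

variable [FiniteDimensional ℝ V]

theorem adjoint_J_left (h : IsNilpotentDolbeault J a W F m) (u v : V) :
    adjoint (a (J u)) v = J (adjoint (a u) v) := by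
  refine ext_inner_right ℝ fun w ↦ ?_
  rw [LinearMap.adjoint_inner_left, h.J_left, h.inner_J_left, LinearMap.adjoint_inner_left,
    h.J_right, inner_neg_right]

theorem adjoint_J_right (h : IsNilpotentDolbeault J a W F m) (u v : V) :
    adjoint (a u) (J v) = J (adjoint (a u) v) := by
  refine ext_inner_right ℝ fun w ↦ ?_
  rw [LinearMap.adjoint_inner_left, h.inner_J_left, h.inner_J_left, LinearMap.adjoint_inner_left,
    h.J_right]

theorem adjoint_eq_zero (h : IsNilpotentDolbeault J a W F m) {x : V} (hx : x ∈ Wᗮ) (u : V) :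
    adjoint (a u) x = 0 := by
  refine ext_inner_right ℝ fun w ↦ ?_
  rw [LinearMap.adjoint_inner_left, inner_zero_left]
  exact (Submodule.mem_orthogonal' W x).1 hx _ (h.mem u w)

/-- Constant holomorphic sectional curvature must vanish. -/
theorem eq_zero_of_holSec_eq [Nontrivial V] (h : IsNilpotentDolbeault J a W F m) {c : ℝ}
    (hc : ∀ u, holSec a u = c * ‖u‖ ^ 4) : c = 0 := by
  apply le_antisymm
  -- At a vector w orthogonal to all values of a, the first and third terms of `holSec` vanish,
  -- leaving −‖a w w‖². Such a w exists: if the values spanned V, then W = V and every F k would be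
  -- V, against F m = ⊥.
  · let S : Submodule ℝ V := Submodule.span ℝ {x | ∃ u v, a u v = x}
    have hS : S ≠ ⊤ := by
      intro hS
      have hF : ∀ k, F k = ⊤ := by
        intro k
        have hW : W = ⊤ := by
          rw [eq_top_iff, ← hS]
          exact Submodule.span_le.2 (by rintro _ ⟨u, v, rfl⟩; exact h.mem u v)
        induction k with
        | zero => rw [h.zero, hW]
        | succ k ih =>
          rw [eq_top_iff, ← hS]
          refine Submodule.span_le.2 ?_
          rintro _ ⟨u, v, rfl⟩
          exact h.step k u (by simp [hW]) v (by simp [ih])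
      exact bot_ne_top (h.last.symm.trans (hF m))
    have hS' : Sᗮ ≠ ⊥ := by rwa [Ne, Submodule.orthogonal_eq_bot_iff]
    obtain ⟨w, hw, hw0⟩ := Submodule.exists_mem_ne_zero_of_ne_bot hS'
    have hw' : ∀ u v, ⟪w, a u v⟫_ℝ = 0 := fun u v ↦
      (Submodule.mem_orthogonal' S w).1 hw _ (Submodule.subset_span ⟨u, v, rfl⟩)
    have had : adjoint (a w) w = 0 := by
      refine ext_inner_right ℝ fun v ↦ ?_
      rw [LinearMap.adjoint_inner_left, inner_zero_left, hw']
    have hcw := hc w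
    rw [holSec, had, real_inner_comm, hw'] at hcw
    have : 0 < ‖w‖ ^ 4 := by positivity
    have h2 : c * ‖w‖ ^ 4 ≤ 0 := by
      rw [← hcw]; simp
    exact nonpos_of_mul_nonpos_left h2 this
  · by_cases hW : W = ⊥
    · obtain ⟨w, hw0⟩ := exists_ne (0 : V)
      have ha : ∀ u v, a u v = 0 := fun u v ↦ by simpa [hW] using h.mem u v
      have had : adjoint (a w) w = 0 := by
        refine ext_inner_right ℝ fun v ↦ ?_
        rw [LinearMap.adjoint_inner_left, inner_zero_left, ha, inner_zero_right]
      have hcw := hc w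
      rw [holSec, had, ha] at hcw
      have : 0 < ‖w‖ ^ 4 := by positivity
      simp at hcw
      rcases hcw with h | h
      · exact h.ge
      · exact absurd h hw0
    -- At a killed vector the second and third terms of `holSec` vanish, leaving a square.
    · obtain ⟨w, hw, hw0, hk⟩ := h.exists_killed le_rfl hW fun u _ v _ ↦ h.mem u v
      have hcw := hc w
      rw [holSec, hk w hw] at hcw
      have : 0 < ‖w‖ ^ 4 := by positivity
      have h2 : 0 ≤ c * ‖w‖ ^ 4 := by
        rw [← hcw]; simp
      exact nonneg_of_mul_nonneg_left h2 this

/-- Polarization of the vanishing holomorphic sectional curvature at a killed vector. -/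
theorem polarized_holSec (h : IsNilpotentDolbeault J a W F m) (hH : ∀ u, holSec a u = 0)
    {n u : V} (hn : n ∈ W) (hu : u ∈ W) (hk : ∀ u ∈ W, a u n = 0) :
    ‖adjoint (a n) u + adjoint (a u) n‖ ^ 2 - ‖a n u‖ ^ 2 - 2 * ⟪a (a n u) u, n⟫_ℝ = 0 := by
  have hJu := h.J_mem u hu
  have k1 := hk n hn
  have k2 := hk u hu
  have k3 := hk _ hJu
  have ks := hk _ (h.mem n u)
  have kt := hk _ (h.mem u u)
  have kJs := hk _ (h.J_mem _ (h.mem n u))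
  -- Averaging over n + tu with t = ±1, ±i keeps the phase-invariant part in t. After removing the
  -- pure terms in n and in u, only the part quadratic in both remains.
  have e0 := hH n
  have e1 := hH u
  have e2 := hH (n + u)
  have e3 := hH (n - u)
  have e4 := hH (n + J u)
  have e5 := hH (n - J u)
  simp only [holSec, map_add, map_sub, LinearMap.add_apply, LinearMap.sub_apply, k1, k2, k3, ks, kt,
    h.adjoint_J_left, h.adjoint_J_right, h.J_left, h.J_right, h.J_J,
    LinearMap.zero_apply, map_zero, neg_neg, ← real_inner_self_eq_norm_sq,
    inner_add_left, inner_add_right, inner_sub_left, inner_sub_right, inner_neg_left,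
    inner_neg_right, inner_zero_left, inner_zero_right, h.inner_J,
    real_inner_comm] at e0 e1 e2 e3 e4 e5 ⊢
  linarith

/-- Trace the polarized identity over u ∈ W. The squares of a_n and a_n^* cancel, the cross term
cancels the term ⟨a(a_n u)u, n⟩, and Σ‖a_u^* n‖² ≤ 0 is left. -/
theorem inner_eq_zero_of_killed (h : IsNilpotentDolbeault J a W F m) (hH : ∀ u, holSec a u = 0)
    {n : V} (hn : n ∈ W) (hk : ∀ u ∈ W, a u n = 0) {u v : V} (hu : u ∈ W) (hv : v ∈ W) :
    ⟪n, a u v⟫_ℝ = 0 := by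
  let A : W →ₗ[ℝ] W →ₗ[ℝ] W := LinearMap.mk₂ ℝ (fun x y ↦ ⟨a x y, h.mem x y⟩)
    -- The trace is taken inside W, where killedness of n applies. Adjoints there are orthogonal
    -- projections of the adjoints on V, so the identity becomes an inequality in the useful
    -- direction.
    (fun _ _ _ ↦ by simp) (fun _ _ _ ↦ by simp) (fun _ _ _ ↦ by simp) (fun _ _ _ ↦ by simp)
  have hA : ∀ x y : W, (A x y : V) = a x y := fun _ _ ↦ rfl
  let N : W := ⟨n, hn⟩
  let b := stdOrthonormalBasis ℝ W
  have hproj : ∀ x y : W, adjoint (A x) y = W.orthogonalProjectionOnto (adjoint (a x) (y : V)) := by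
    intro x y
    refine ext_inner_right ℝ fun z ↦ ?_
    rw [LinearMap.adjoint_inner_left, Submodule.inner_orthogonalProjectionOnto_eq_of_mem_right,
      LinearMap.adjoint_inner_left, Submodule.coe_inner, hA]
  have hle : ∀ x : W, ‖adjoint (A N) x + adjoint (A x) N‖ ^ 2
      ≤ ‖A N x‖ ^ 2 + 2 * ⟪A (A N x) x, N⟫_ℝ := by
    intro x
    have h1 := h.polarized_holSec hH hn x.2 hk
    have h2 : ‖adjoint (A N) x + adjoint (A x) N‖ ≤ ‖adjoint (a n) (x : V) + adjoint (a x) n‖ := by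
      rw [hproj, hproj, ← map_add]
      exact W.norm_orthogonalProjectionOnto_apply_le _
    have h3 := pow_le_pow_left₀ (norm_nonneg _) h2 2
    have h4 : ‖A N x‖ = ‖a n x‖ := rfl
    have h5 : ⟪A (A N x) x, N⟫_ℝ = ⟪a (a n x) x, n⟫_ℝ := rfl
    rw [h4, h5]
    linarith
  have hsum := Finset.sum_le_sum fun i (_ : i ∈ Finset.univ) ↦ hle (b i)
  simp only [norm_add_sq_real, Finset.sum_add_distrib, ← Finset.mul_sum,
    b.sum_norm_sq_adjoint] at hsum
  -- Moving A_N^* across the trace turns Σ⟨A_b(A_N^* b), N⟩ into Σ⟨A_{A_N b} b, N⟩.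
  have hcross : ∑ i, ⟪adjoint (A N) (b i), adjoint (A (b i)) N⟫_ℝ
      = ∑ i, ⟪A (A N (b i)) (b i), N⟫_ℝ := by
    have := b.sum_apply_adjoint (A N) (A.compr₂ (innerₗ W N))
    simp only [LinearMap.compr₂_apply, innerₗ_apply_apply] at this
    rw [Finset.sum_congr rfl fun i _ ↦ real_inner_comm N (A (A N (b i)) (b i)), ← this]
    exact Finset.sum_congr rfl fun i _ ↦ by
      rw [LinearMap.adjoint_inner_right, real_inner_comm]
  have hz : ∑ i, ‖adjoint (A (b i)) N‖ ^ 2 = 0 :=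
    le_antisymm (by linarith) (Finset.sum_nonneg fun i _ ↦ by positivity)
  rw [Finset.sum_eq_zero_iff_of_nonneg fun i _ ↦ by positivity] at hz
  have hz' : ∀ x y : W, ⟪N, A x y⟫_ℝ = 0 := by
    intro x y
    rw [← b.sum_repr' x]
    simp only [map_sum, map_smul, LinearMap.sum_apply, LinearMap.smul_apply, inner_sum,
      inner_smul_right]
    refine Finset.sum_eq_zero fun i hi ↦ ?_
    have := hz i hi
    rw [sq_eq_zero_iff, norm_eq_zero] at this
    rw [← LinearMap.adjoint_inner_left, this, inner_zero_left, mul_zero]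
  exact hz' ⟨u, hu⟩ ⟨v, hv⟩

/-- Let K be the killed vectors of W orthogonal to a(W, W). Then W ⊓ Kᗮ is invariant, so if nonzero
it contains a killed vector. By `inner_eq_zero_of_killed` that vector also lies in K, a
contradiction. Hence K = W. -/
theorem apply_eq_zero_of_mem (h : IsNilpotentDolbeault J a W F m) (hH : ∀ u, holSec a u = 0)
    {u v : V} (hu : u ∈ W) (hv : v ∈ W) : a u v = 0 := by
  let K : Submodule ℝ V :=
    { carrier := {w | w ∈ W ∧ (∀ u ∈ W, a u w = 0) ∧ ∀ u ∈ W, ∀ v ∈ W, ⟪w, a u v⟫_ℝ = 0}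
      zero_mem' := ⟨W.zero_mem, by simp, by simp⟩
      add_mem' := fun hx hy ↦ ⟨W.add_mem hx.1 hy.1,
        fun u hu ↦ by rw [map_add, hx.2.1 u hu, hy.2.1 u hu, add_zero],
        fun u hu v hv ↦ by rw [inner_add_left, hx.2.2 u hu v hv, hy.2.2 u hu v hv, add_zero]⟩
      smul_mem' := fun c x hx ↦ ⟨W.smul_mem c hx.1,
        fun u hu ↦ by rw [map_smul, hx.2.1 u hu, smul_zero],
        fun u hu v hv ↦ by rw [inner_smul_left, hx.2.2 u hu v hv, mul_zero]⟩ }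
  have hKW : K ≤ W := fun x hx ↦ hx.1
  have hS : W ⊓ Kᗮ = ⊥ := by
    by_contra hne
    obtain ⟨n, hn, hn0, hk⟩ := h.exists_killed inf_le_left hne fun u hu v hv ↦
      ⟨h.mem u v, (Submodule.mem_orthogonal K _).2 fun k hk ↦ hk.2.2 u hu v hv.1⟩
    have hnK : n ∈ K := ⟨hn.1, hk, fun u hu v hv ↦ h.inner_eq_zero_of_killed hH hn.1 hk hu hv⟩
    have : n ∈ K ⊓ Kᗮ := ⟨hnK, hn.2⟩
    rw [Submodule.inf_orthogonal_eq_bot] at this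
    exact hn0 (by simpa using this)
  have hvK : v ∈ K := by
    have h1 : v - K.starProjection v ∈ W ⊓ Kᗮ :=
      ⟨W.sub_mem hv (hKW (K.starProjection_apply_mem v)), K.sub_starProjection_mem_orthogonal v⟩
    rw [hS, Submodule.mem_bot, sub_eq_zero] at h1
    rw [h1]
    exact K.starProjection_apply_mem v
  exact hvK.2.1 u hu

theorem adjoint_self_eq_zero (h : IsNilpotentDolbeault J a W F m) (hH : ∀ u, holSec a u = 0)
    {w : V} (hw : w ∈ W) : adjoint (a w) w = 0 := by
  have := hH w
  rw [holSec, h.apply_eq_zero_of_mem hH hw hw] at this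
  simpa using this

/-- Polarization of ⟪w, a w x⟫ = 0, which holds on W because a_w^* w = 0. -/
theorem inner_skew (h : IsNilpotentDolbeault J a W F m) (hH : ∀ u, holSec a u = 0)
    {u v : V} (hu : u ∈ W) (hv : v ∈ W) (x : V) : ⟪a u x, v⟫_ℝ = -⟪u, a v x⟫_ℝ := by
  have key : ∀ w ∈ W, ⟪w, a w x⟫_ℝ = 0 := fun w hw ↦ by
    rw [← LinearMap.adjoint_inner_left, h.adjoint_self_eq_zero hH hw, inner_zero_left]
  have := key _ (W.add_mem hu hv)
  simp only [map_add, LinearMap.add_apply, inner_add_left, inner_add_right, key u hu,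
    key v hv] at this
  rw [real_inner_comm]
  linarith

/-- On Wᗮ the curvature reduces to −‖a z z‖², so a is alternating there. Replacing x by Jx makes it
symmetric as well, being conjugate linear on the left and linear on the right. -/
theorem apply_eq_zero_of_mem_orthogonal (h : IsNilpotentDolbeault J a W F m)
    (hH : ∀ u, holSec a u = 0) {x y : V} (hx : x ∈ Wᗮ) (hy : y ∈ Wᗮ) : a x y = 0 := by
  have key : ∀ z ∈ Wᗮ, a z z = 0 := by
    intro z hz
    have := hH z
    rw [holSec, h.adjoint_eq_zero hz,
      (Submodule.mem_orthogonal W z).1 hz _ (h.mem (a z z) z)] at this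
    simpa using this
  have skew : ∀ x ∈ Wᗮ, a x y + a y x = 0 := by
    intro x hx
    have := key _ (Wᗮ.add_mem hx hy)
    simpa [key x hx, key y hy] using this
  have h1 := skew x hx
  have h2 := congrArg J (skew _ (h.J_mem_orthogonal hx))
  rw [h.J_left, h.J_right, map_add, map_neg, h.J_J, h.J_J, neg_neg, map_zero] at h2
  have h3 : (2 : ℝ) • a x y = 0 := by
    have : (2 : ℝ) • a x y = (a x y + a y x) + (a x y + -a y x) := by module
    rw [this, h1, h2, add_zero]
  simpa using h3

/-- Vanishing curvature at x + w. By skewness the third term is 2⟪a x w + a w x, a w x⟫, which flips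
the sign of ‖a w x‖² and removes the cross term. -/
theorem holSec_add (h : IsNilpotentDolbeault J a W F m) (hH : ∀ u, holSec a u = 0)
    {x w : V} (hx : x ∈ Wᗮ) (hw : w ∈ W) :
    ‖adjoint (a x) w‖ ^ 2 - ‖a x w‖ ^ 2 + ‖a w x‖ ^ 2 = 0 := by
  have := hH (x + w)
  have hs : a (x + w) (x + w) = a x w + a w x := by
    simp [h.apply_eq_zero_of_mem_orthogonal hH hx hx, h.apply_eq_zero_of_mem hH hw hw]
  have had : adjoint (a (x + w)) (x + w) = adjoint (a x) w := by
    simp [h.adjoint_eq_zero hx, h.adjoint_self_eq_zero hH hw]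
  have hst : a x w + a w x ∈ W := W.add_mem (h.mem _ _) (h.mem _ _)
  have h0 : ⟪a (a x w + a w x) x, x⟫_ℝ = 0 := (Submodule.mem_orthogonal W x).1 hx _ (h.mem _ _)
  rw [holSec, hs, had, map_add (a (a x w + a w x)) x w, h.apply_eq_zero_of_mem hH hst hw, add_zero,
    inner_add_right, h0, h.inner_skew hH hst hw, norm_add_sq_real, inner_add_left,
    real_inner_self_eq_norm_sq] at this
  linarith

/-- Trace `holSec_add` over w ∈ W: the Hilbert–Schmidt norms of a x on W and of its adjoint cancel,
leaving Σ‖a w x‖² ≤ 0. -/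
theorem apply_mem_orthogonal_eq_zero (h : IsNilpotentDolbeault J a W F m)
    (hH : ∀ u, holSec a u = 0) {x w : V} (hx : x ∈ Wᗮ) (hw : w ∈ W) : a w x = 0 := by
  let S : W →ₗ[ℝ] W := ((a x).comp W.subtype).codRestrict W fun w ↦ h.mem x w
  let b := stdOrthonormalBasis ℝ W
  have hproj : ∀ y : W, adjoint S y = W.orthogonalProjectionOnto (adjoint (a x) (y : V)) := by
    intro y
    refine ext_inner_right ℝ fun z ↦ ?_
    rw [LinearMap.adjoint_inner_left, Submodule.inner_orthogonalProjectionOnto_eq_of_mem_right,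
      LinearMap.adjoint_inner_left, Submodule.coe_inner]
    rfl
  have hle : ∀ y : W, ‖adjoint S y‖ ^ 2 + ‖a y x‖ ^ 2 ≤ ‖S y‖ ^ 2 := by
    intro y
    have h1 := h.holSec_add hH hx y.2
    have h2 : ‖adjoint S y‖ ≤ ‖adjoint (a x) (y : V)‖ := by
      rw [hproj]
      exact W.norm_orthogonalProjectionOnto_apply_le _
    have h3 := pow_le_pow_left₀ (norm_nonneg _) h2 2
    have h4 : ‖S y‖ = ‖a x y‖ := rfl
    rw [h4]
    linarith
  have hsum := Finset.sum_le_sum fun i (_ : i ∈ Finset.univ) ↦ hle (b i)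
  rw [Finset.sum_add_distrib, b.sum_norm_sq_adjoint] at hsum
  have hz : ∑ i, ‖a (b i) x‖ ^ 2 = 0 :=
    le_antisymm (by linarith) (Finset.sum_nonneg fun i _ ↦ by positivity)
  rw [Finset.sum_eq_zero_iff_of_nonneg fun i _ ↦ by positivity] at hz
  have hz' : ∀ y : W, a y x = 0 := by
    intro y
    rw [← b.sum_repr' y]
    simp only [Submodule.coe_sum, Submodule.coe_smul, map_sum, map_smul, LinearMap.sum_apply,
      LinearMap.smul_apply]
    refine Finset.sum_eq_zero fun i hi ↦ ?_
    have := hz i hi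
    rw [sq_eq_zero_iff, norm_eq_zero] at this
    rw [this, smul_zero]
  exact hz' ⟨w, hw⟩

/-- If the holomorphic sectional curvature vanishes, then `a` vanishes in the directions of `W`. -/
theorem eq_zero_of_mem (h : IsNilpotentDolbeault J a W F m)
    (hH : ∀ u, holSec a u = 0) {w : V} (hw : w ∈ W) : a w = 0 := by
  ext v
  obtain ⟨y, hy, z, hz, rfl⟩ := W.exists_add_mem_mem_orthogonal v
  rw [map_add, h.apply_eq_zero_of_mem hH hw hy, h.apply_mem_orthogonal_eq_zero hH hz hw]
  simp

/-- Only the Wᗮ-component of u and the W-component of v contribute, and for these `holSec_add` is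
the claim. Polarized in v, it says that a u is normal. -/
theorem norm_adjoint_eq (h : IsNilpotentDolbeault J a W F m)
    (hH : ∀ u, holSec a u = 0) (u v : V) : ‖adjoint (a u) v‖ ^ 2 = ‖a u v‖ ^ 2 := by
  obtain ⟨w, hw, x, hx, rfl⟩ := W.exists_add_mem_mem_orthogonal u
  obtain ⟨y, hy, z, hz, rfl⟩ := W.exists_add_mem_mem_orthogonal v
  have := h.holSec_add hH hx hy
  rw [h.apply_mem_orthogonal_eq_zero hH hx hy] at this
  rw [map_add a, h.eq_zero_of_mem hH hw, zero_add, map_add, map_add,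
    h.apply_eq_zero_of_mem_orthogonal hH hx hz, h.adjoint_eq_zero hz, add_zero, add_zero]
  simpa [sub_eq_zero] using this

theorem normal (h : IsNilpotentDolbeault J a W F m)
    (hH : ∀ u, holSec a u = 0) (u v : V) : a u (adjoint (a u) v) = adjoint (a u) (a u v) := by
  refine ext_inner_right ℝ fun w ↦ ?_
  rw [LinearMap.adjoint_inner_left, ← LinearMap.adjoint_inner_right]
  have h1 := h.norm_adjoint_eq hH u (v + w)
  rw [map_add, map_add, norm_add_sq_real, norm_add_sq_real, h.norm_adjoint_eq hH,
    h.norm_adjoint_eq hH] at h1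
  linarith

/-- If the holomorphic sectional curvature vanishes, then the `(0,1)`- and the `(1,0)`-parts of the
connection commute. -/
theorem commute_adjoint (h : IsNilpotentDolbeault J a W F m)
    (hH : ∀ u, holSec a u = 0) (u v z : V) :
    a u (adjoint (a v) z) = adjoint (a v) (a u z) := by
  -- Normality of a (u + v) gives the sum of two commutators; substituting Ju changes the relative
  -- sign and separates them.
  have key : ∀ u, a u (adjoint (a v) z) + a v (adjoint (a u) z)
      = adjoint (a v) (a u z) + adjoint (a u) (a v z) := by
    intro u
    have := h.normal hH (u + v) z
    simp only [map_add, LinearMap.add_apply, h.normal hH u, h.normal hH v] at this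
    linear_combination (norm := module) this
  have h1 := key u
  have h2 := congrArg J (key (J u))
  simp only [h.J_left, h.adjoint_J_left, h.J_right, h.adjoint_J_right, map_add, map_neg, h.J_J,
    neg_neg] at h2
  have h3 : (2 : ℝ) • a u (adjoint (a v) z) = (2 : ℝ) • adjoint (a v) (a u z) := by
    linear_combination (norm := module) h1 + h2
  exact smul_right_injective V two_ne_zero h3

end IsNilpotentDolbeault

end LinearAlgebra

end

noncomputable section

/-! ### The Chern connection on a Hermitian Lie algebra -/

section ChernAlgebra

open scoped InnerProductSpace
open LinearMap (adjoint)

/-- `nab` is the Chern connection of the left-invariant Hermitian structure `(J, g)` on a Lie algebra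
with bracket `br`. -/
structure IsChernAlgebra {V : Type*} [AddCommGroup V] [Module ℝ V] (g : V →ₗ[ℝ] V →ₗ[ℝ] ℝ)
    (J : V →ₗ[ℝ] V) (br nab : V →ₗ[ℝ] V →ₗ[ℝ] V) : Prop where
  symm : ∀ u v, g u v = g v u
  pos : ∀ u, u ≠ 0 → 0 < g u u
  J_J : ∀ u, J (J u) = -u
  metric_J : ∀ u v, g (J u) (J v) = g u v
  skew : ∀ u v, br u v = -br v u
  jacobi : ∀ u v w, br u (br v w) = br (br u v) w + br v (br u w)
  integrable : ∀ u v, br u v - br (J u) (J v) + J (br (J u) v) + J (br u (J v)) = 0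
  metric : ∀ u v w, g (nab u v) w + g v (nab u w) = 0
  parallel_J : ∀ u v, nab u (J v) = J (nab u v)
  torsion_J : ∀ u v, nab (J u) (J v) - nab (J v) (J u) - br (J u) (J v)
    = -(nab u v - nab v u - br u v)

/-- The `(0,1)`-part of the Chern connection, as a function of the bracket. -/
def dolbeault {V : Type*} [AddCommGroup V] [Module ℝ V]
    (J : V →ₗ[ℝ] V) (br : V →ₗ[ℝ] V →ₗ[ℝ] V) : V →ₗ[ℝ] V →ₗ[ℝ] V :=
  (1 / 2 : ℝ) • (br + (br.comp J).compr₂ J)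

theorem dolbeault_apply {V : Type*} [AddCommGroup V] [Module ℝ V]
    (J : V →ₗ[ℝ] V) (br : V →ₗ[ℝ] V →ₗ[ℝ] V) (u v : V) :
    dolbeault J br u v = (1 / 2 : ℝ) • (br u v + J (br (J u) v)) := by
  simp [dolbeault]

/-- The curvature of the left-invariant connection `nab`. -/
def algCurvature {V : Type*} [AddCommGroup V] [Module ℝ V]
    (br nab : V →ₗ[ℝ] V →ₗ[ℝ] V) (u v w : V) : V :=
  nab u (nab v w) - nab v (nab u w) - nab (br u v) w

/-! ### Unitary frames in real terms -/

section UnitaryFrame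

variable {V : Type*} [NormedAddCommGroup V] [InnerProductSpace ℝ V] {J : V →ₗ[ℝ] V}

/-- The complex vector e − √-1 Je has squared length 2|e|², so a unitary frame has real parts of
squared length 1/2, and √2 restores the unit length. -/
theorem orthonormal_of_unitaryFrame (hJ : ∀ u v, ⟪J u, J v⟫_ℝ = ⟪u, v⟫_ℝ)
    (hJ' : ∀ u v, ⟪J u, v⟫_ℝ = -⟪u, J v⟫_ℝ) {n : ℕ} {e : Fin n → V}
    (he : ∀ i j, ⟪e i, e j⟫_ℝ = if i = j then 1 / 2 else 0) (heJ : ∀ i j, ⟪e i, J (e j)⟫_ℝ = 0) :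
    Orthonormal ℝ (Sum.elim (fun i ↦ √2 • e i) (fun i ↦ √2 • J (e i))) := by
  have h2 : (√2 : ℝ) * √2 = 2 := Real.mul_self_sqrt (by norm_num)
  rw [orthonormal_iff_ite]
  rintro (i | i) (j | j) <;>
    simp [inner_smul_left, inner_smul_right, he, heJ, hJ, hJ'] <;>
    split_ifs <;> linarith

/-- A frame of maximal length spans: otherwise a vector orthogonal to all e i and J (e i), rescaled,
extends it. -/
theorem exists_unitaryFrame [FiniteDimensional ℝ V] (hJ : ∀ u v, ⟪J u, J v⟫_ℝ = ⟪u, v⟫_ℝ)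
    (hJ' : ∀ u v, ⟪J u, v⟫_ℝ = -⟪u, J v⟫_ℝ) :
    ∃ (n : ℕ) (e : Fin n → V), Module.finrank ℝ V = 2 * n ∧
      (∀ i j, ⟪e i, e j⟫_ℝ = if i = j then 1 / 2 else 0) ∧ ∀ i j, ⟪e i, J (e j)⟫_ℝ = 0 := by
  classical
  let P : ℕ → Prop := fun n ↦ ∃ e : Fin n → V,
    (∀ i j, ⟪e i, e j⟫_ℝ = if i = j then 1 / 2 else 0) ∧ ∀ i j, ⟪e i, J (e j)⟫_ℝ = 0
  have hle : ∀ n, P n → 2 * n ≤ Module.finrank ℝ V := by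
    rintro n ⟨e, he, heJ⟩
    have := (orthonormal_of_unitaryFrame hJ hJ' he heJ).linearIndependent.fintype_card_le_finrank
    simp only [Fintype.card_sum, Fintype.card_fin] at this
    omega
  have hstep : ∀ n, P n → 2 * n < Module.finrank ℝ V → P (n + 1) := by
    rintro n ⟨e, he, heJ⟩ hlt
    set f := Sum.elim (fun i ↦ √2 • e i) (fun i ↦ √2 • J (e i)) with hfdef
    have hf : Orthonormal ℝ f := orthonormal_of_unitaryFrame hJ hJ' he heJ
    have hs : Submodule.span ℝ (Set.range f) ≠ ⊤ := by
      intro h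
      have := finrank_span_eq_card hf.linearIndependent
      rw [h, finrank_top] at this
      simp only [Fintype.card_sum, Fintype.card_fin] at this
      omega
    rw [Ne, ← Submodule.orthogonal_eq_bot_iff] at hs
    obtain ⟨x, hx, hx0⟩ := Submodule.exists_mem_ne_zero_of_ne_bot hs
    have hxf : ∀ i, ⟪f i, x⟫_ℝ = 0 := fun i ↦
      (Submodule.mem_orthogonal _ x).1 hx _ (Submodule.subset_span ⟨i, rfl⟩)
    have h2 : (√2 : ℝ) ≠ 0 := by positivity
    have hx1 : ∀ i, ⟪e i, x⟫_ℝ = 0 := fun i ↦ by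
      simpa [hfdef, inner_smul_left, h2] using hxf (Sum.inl i)
    have hx2 : ∀ i, ⟪J (e i), x⟫_ℝ = 0 := fun i ↦ by
      simpa [hfdef, inner_smul_left, h2] using hxf (Sum.inr i)
    have hx3 : ⟪x, J x⟫_ℝ = 0 := by
      have := hJ' x x
      rw [real_inner_comm] at this
      linarith
    let y := (√2 * ‖x‖)⁻¹ • x
    have hyy : ⟪y, y⟫_ℝ = 2⁻¹ := by
      simp only [y, inner_smul_left, inner_smul_right, real_inner_self_eq_norm_sq, conj_trivial]
      have : ‖x‖ ≠ 0 := norm_ne_zero_iff.2 hx0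
      field_simp
      norm_num
    have hey : ∀ i, ⟪e i, y⟫_ℝ = 0 := fun i ↦ by simp [y, inner_smul_right, hx1]
    have hye : ∀ i, ⟪y, e i⟫_ℝ = 0 := fun i ↦ by rw [real_inner_comm, hey]
    have hyJ : ∀ i, ⟪y, J (e i)⟫_ℝ = 0 := fun i ↦ by
      rw [real_inner_comm]; simp [y, inner_smul_right, hx2]
    have heJy : ∀ i, ⟪e i, J y⟫_ℝ = 0 := fun i ↦ by
      have := hJ' (e i) y
      rw [real_inner_comm, hyJ] at this
      linarith
    have hyJy : ⟪y, J y⟫_ℝ = 0 := by simp [y, inner_smul_left, inner_smul_right, hx3]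
    refine ⟨Fin.cons y e, ?_, ?_⟩
    · intro i j
      refine Fin.cases ?_ (fun i ↦ ?_) i <;> refine Fin.cases ?_ (fun j ↦ ?_) j
      · simpa using hyy
      · simpa [(Fin.succ_ne_zero j).symm] using hye j
      · simpa using hey i
      · simpa using he i j
    · intro i j
      refine Fin.cases ?_ (fun i ↦ ?_) i <;> refine Fin.cases ?_ (fun j ↦ ?_) j
      · simpa using hyJy
      · simpa using hyJ j
      · simpa using heJy i
      · simpa using heJ i j
  have h0 : P 0 := ⟨Fin.elim0, fun i ↦ i.elim0, fun i ↦ i.elim0⟩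
  let n := Nat.findGreatest P (Module.finrank ℝ V)
  have hn : P n := Nat.findGreatest_spec (Nat.zero_le _) h0
  have hn' : Module.finrank ℝ V = 2 * n := by
    refine le_antisymm ?_ (hle n hn)
    by_contra hlt
    have h1 := hstep n hn (by omega)
    have h2 := hle _ h1
    have := Nat.le_findGreatest (P := P) (n := Module.finrank ℝ V) (by omega) h1
    exact absurd this (by simp [n])
  obtain ⟨e, he, heJ⟩ := hn
  exact ⟨n, e, hn', he, heJ⟩

end UnitaryFrame

namespace IsChernAlgebra

/-! ### Connection and curvature in terms of the bracket -/

section General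

variable {V : Type*} [AddCommGroup V] [Module ℝ V] {g : V →ₗ[ℝ] V →ₗ[ℝ] ℝ}
    {J : V →ₗ[ℝ] V} {br nab nab' : V →ₗ[ℝ] V →ₗ[ℝ] V}

theorem dolbeault_J_left (h : IsChernAlgebra g J br nab) (u v : V) :
    dolbeault J br (J u) v = -J (dolbeault J br u v) := by
  simp only [dolbeault_apply, h.J_J, map_neg, LinearMap.neg_apply, map_smul, map_add]
  module

/-- This is J applied to the vanishing of the Nijenhuis tensor. -/
theorem dolbeault_J_right (h : IsChernAlgebra g J br nab) (u v : V) :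
    dolbeault J br u (J v) = J (dolbeault J br u v) := by
  have := congrArg J (h.integrable u v)
  simp only [map_add, map_sub, h.J_J, map_zero] at this
  simp only [dolbeault_apply, h.J_J, map_smul, map_add]
  linear_combination (norm := module) (-1 / 2 : ℝ) • this

theorem metric_J_left (h : IsChernAlgebra g J br nab) (u v : V) : g (J u) v = -g u (J v) := by
  have := h.metric_J u (J v)
  rw [h.J_J, map_neg] at this
  linarith

/-- The torsion condition at (u, v) and at (u, Jv), together with integrability, forces the
(0,1)-part of the connection to be the bracket expression. -/
theorem dolbeault_eq (h : IsChernAlgebra g J br nab) (u v : V) :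
    dolbeault J br u v = (1 / 2 : ℝ) • (nab u v + J (nab (J u) v)) := by
  have h1 := h.torsion_J u v
  have h2 := congrArg J (h.torsion_J u (J v))
  have h3 := h.integrable u v
  simp only [h.parallel_J, h.J_J, map_neg, map_sub, LinearMap.neg_apply] at h1 h2
  rw [dolbeault_apply]
  linear_combination (norm := module) (-1 / 4 : ℝ) • h1 + (1 / 4 : ℝ) • h2 + (1 / 4 : ℝ) • h3

/-- Metric compatibility makes the (1,0)-part minus the adjoint of the (0,1)-part, so the bracket
determines the whole connection. -/
theorem metric_nab (h : IsChernAlgebra g J br nab) (u v w : V) :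
    g (nab u v) w = g (dolbeault J br u v) w - g v (dolbeault J br u w) := by
  have h1 := h.metric u v w
  have h2 := h.metric (J u) (J v) w
  rw [h.parallel_J, h.metric_J_left v] at h2
  simp only [h.dolbeault_eq, map_smul, map_add, LinearMap.smul_apply, LinearMap.add_apply,
    smul_eq_mul]
  linarith

theorem eq_of_forall_metric (h : IsChernAlgebra g J br nab) {x y : V}
    (hxy : ∀ w, g x w = g y w) : x = y := by
  by_contra hne
  have h1 := h.pos _ (sub_ne_zero.2 hne)
  rw [map_sub g, LinearMap.sub_apply, hxy, sub_self] at h1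
  exact lt_irrefl _ h1

/-- The Chern connection of a left-invariant Hermitian structure is unique. -/
theorem unique (h : IsChernAlgebra g J br nab) (h' : IsChernAlgebra g J br nab') : nab' = nab := by
  ext u v
  exact h.eq_of_forall_metric fun w ↦ by rw [h.metric_nab, h'.metric_nab]

/-- Flatness of the (0,1)-part: the Jacobi identity for u + √-1 Ju and v + √-1 Jv. By integrability
their bracket is z + √-1 Jz with z = [u, v] − [Ju, Jv]. -/
theorem dolbeault_commutator (h : IsChernAlgebra g J br nab) (u v w : V) :
    dolbeault J br u (dolbeault J br v w) - dolbeault J br v (dolbeault J br u w)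
      = (1 / 2 : ℝ) • dolbeault J br (br u v - br (J u) (J v)) w := by
  have key : ∀ u v, dolbeault J br u (dolbeault J br v w) = (1 / 2 : ℝ) •
      (dolbeault J br u (br v w) + J (dolbeault J br u (br (J v) w))) := by
    intro u v
    conv_lhs => rw [dolbeault_apply J br v w]
    rw [map_smul, map_add, h.dolbeault_J_right]
  have hz : J (br u v - br (J u) (J v)) = br (J u) v + br u (J v) := by
    have := congrArg J (h.integrable u v)
    simp only [map_add, map_sub, h.J_J, map_zero] at this ⊢
    linear_combination (norm := module) this
  rw [key, key]
  simp only [dolbeault_apply]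
  rw [hz]
  simp only [map_smul, map_add, map_sub, LinearMap.add_apply, LinearMap.sub_apply, h.J_J]
  rw [h.jacobi u v w, h.jacobi (J u) v w, h.jacobi (J u) (J v) w, h.jacobi u (J v) w]
  simp only [map_add]
  module

end General

section Inner

variable {V : Type*} [NormedAddCommGroup V] [InnerProductSpace ℝ V] [FiniteDimensional ℝ V]
    {J : V →ₗ[ℝ] V} {br nab : V →ₗ[ℝ] V →ₗ[ℝ] V} {W : Submodule ℝ V}
  {F : ℕ → Submodule ℝ V} {m : ℕ}

theorem nab_eq (h : IsChernAlgebra (innerₗ V) J br nab) (u v : V) :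
    nab u v = dolbeault J br u v - adjoint (dolbeault J br u) v := by
  refine ext_inner_right ℝ fun w ↦ ?_
  rw [inner_sub_left, LinearMap.adjoint_inner_left]
  exact h.metric_nab u v w

/-- Since [u, Ju] = 2J a_u u, the operator R(u, Ju) is 2J applied to −[a_u, a_u^*] plus a_w + a_w^*,
where w = a_u u. -/
theorem inner_curvature (h : IsChernAlgebra (innerₗ V) J br nab)
    (hd : IsNilpotentDolbeault J (dolbeault J br) W F m) (u z : V) :
    ⟪algCurvature br nab u (J u) z, J z⟫_ℝ =
      -2 * (‖adjoint (dolbeault J br u) z‖ ^ 2 - ‖dolbeault J br u z‖ ^ 2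
        - 2 * ⟪dolbeault J br (dolbeault J br u u) z, z⟫_ℝ) := by
  set a := dolbeault J br with ha
  have hb : br u (J u) = (2 : ℝ) • J (a u u) := by
    have h1 := h.skew u u
    have h2 : br u u = 0 := by
      have : (2 : ℝ) • br u u = 0 := by linear_combination (norm := module) h1
      simpa using this
    rw [ha, dolbeault_apply, h2, h.skew (J u) u]
    simp only [map_smul, map_add, h.J_J, map_neg, map_zero]
    module
  have hR : algCurvature br nab u (J u) z = J (-(2 : ℝ) • (a u (adjoint (a u) z)
      - adjoint (a u) (a u z)) + (2 : ℝ) • (a (a u u) z + adjoint (a (a u u)) z)) := by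
    rw [algCurvature, hb]
    simp only [h.nab_eq, ← ha, map_smul, LinearMap.smul_apply, hd.J_left, hd.adjoint_J_left,
      map_sub, map_add, map_neg, hd.J_right, hd.adjoint_J_right]
    module
  rw [hR, hd.inner_J]
  simp only [inner_add_left, inner_smul_left, inner_sub_left, LinearMap.adjoint_inner_left,
    ← real_inner_self_eq_norm_sq, conj_trivial]
  rw [real_inner_comm (a u (adjoint (a u) z)) z, real_inner_comm (a (a u u) z) z]
  ring

/-- The first Ricci curvature of the Chern connection vanishes. -/
theorem sum_inner_curvature (h : IsChernAlgebra (innerₗ V) J br nab)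
    (hd : IsNilpotentDolbeault J (dolbeault J br) W F m) {n : ℕ}
    (hn : Module.finrank ℝ V = 2 * n) (e : Fin n → V)
    (he : ∀ i j, ⟪e i, e j⟫_ℝ = if i = j then 1 / 2 else 0) (heJ : ∀ i j, ⟪e i, J (e j)⟫_ℝ = 0)
    (u : V) : ∑ i, ⟪algCurvature br nab u (J u) (e i), J (e i)⟫_ℝ = 0 := by
  set a := dolbeault J br with ha
  have h2 : (√2 : ℝ) * √2 = 2 := Real.mul_self_sqrt (by norm_num)
  let f : Fin n ⊕ Fin n → V := Sum.elim (fun i ↦ √2 • e i) (fun i ↦ √2 • J (e i))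
  have hf : Orthonormal ℝ f := orthonormal_of_unitaryFrame hd.inner_J hd.inner_J_left he heJ
  have hcard : Fintype.card (Fin n ⊕ Fin n) = Module.finrank ℝ V := by simp [hn]; ring
  let b := OrthonormalBasis.mk hf
    (hf.linearIndependent.span_eq_top_of_card_eq_finrank' hcard).ge
  have hb : ∀ i, b i = f i := fun i ↦ by simp [b]
  -- Equal Hilbert–Schmidt norms remove the commutator term, and nilpotency of a (a u u) removes the
  -- other. The J (e i) half of each sum equals the e i half.
  have hs := b.sum_norm_sq_adjoint (a u)
  have ht := LinearMap.trace_eq_sum_inner (a (a u u)) b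
  rw [hd.trace_eq_zero (hd.mem u u)] at ht
  have hJn : ∀ x, ‖J x‖ = ‖x‖ := fun x ↦ by
    rw [← sq_eq_sq₀ (norm_nonneg _) (norm_nonneg _), ← real_inner_self_eq_norm_sq, hd.inner_J,
      real_inner_self_eq_norm_sq]
  simp only [hb, f, Fintype.sum_sum_type, Sum.elim_inl, Sum.elim_inr, map_smul, hd.J_right,
    hd.adjoint_J_right, norm_smul, hJn, inner_smul_left, inner_smul_right, hd.inner_J,
    mul_pow, ← Finset.mul_sum, conj_trivial] at hs ht
  simp only [h.inner_curvature hd, ← ha, ← Finset.mul_sum, Finset.sum_sub_distrib]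
  rw [Real.norm_eq_abs, sq_abs, Real.sq_sqrt (by norm_num)] at hs
  rw [Finset.sum_congr rfl fun i _ ↦ real_inner_comm (e i) (a (a u u) (e i))]
  have ht' : ∑ i, ⟪e i, a (a u u) (e i)⟫_ℝ = 0 := by
    rw [← mul_assoc, h2] at ht; linarith
  rw [ht']
  linarith

/-- Brackets lie in W, where a vanishes, so the bracket term drops and the operators a u commute.
They also commute with all adjoints, and the curvature cancels. -/
theorem curvature_eq_zero (h : IsChernAlgebra (innerₗ V) J br nab)
    (hd : IsNilpotentDolbeault J (dolbeault J br) W F m) (hbr : ∀ u v, br u v ∈ W)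
    (hH : ∀ u, holSec (dolbeault J br) u = 0) (u v w : V) : algCurvature br nab u v w = 0 := by
  set a := dolbeault J br with ha
  have hc : ∀ u v w, a u (a v w) = a v (a u w) := by
    intro u v w
    have := h.dolbeault_commutator u v w
    rw [← ha, hd.eq_zero_of_mem hH (W.sub_mem (hbr _ _) (hbr _ _)), LinearMap.zero_apply,
      smul_zero, sub_eq_zero] at this
    exact this
  have hca : adjoint (a u) (adjoint (a v) w) = adjoint (a v) (adjoint (a u) w) := by
    refine ext_inner_right ℝ fun z ↦ ?_
    simp only [LinearMap.adjoint_inner_left, hc v u]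
  rw [algCurvature]
  simp only [h.nab_eq, ← ha, hd.eq_zero_of_mem hH (hbr u v), map_sub, hd.commute_adjoint hH,
    hc v u, hca, map_zero, LinearMap.zero_apply]
  abel

/-- The mixed curvature of the Chern connection is a multiple of the holomorphic sectional
curvature, whose constant values can only be zero. -/
theorem mixed_curvature_inner [Nontrivial V] (h : IsChernAlgebra (innerₗ V) J br nab)
    (hd : IsNilpotentDolbeault J (dolbeault J br) W F m) (hbr : ∀ u v, br u v ∈ W) {α β c : ℝ}
    (hmix : ∀ (n : ℕ) (e : Fin n → V), Module.finrank ℝ V = 2 * n →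
      (∀ i j, ⟪e i, e j⟫_ℝ = if i = j then 1 / 2 else 0) → (∀ i j, ⟪e i, J (e j)⟫_ℝ = 0) →
      ∀ u, ⟪u, u⟫_ℝ = 1 / 2 →
        α * ∑ i, -4 * ⟪algCurvature br nab u (J u) (e i), J (e i)⟫_ℝ
          + β * (-4 * ⟪algCurvature br nab u (J u) u, J u⟫_ℝ) = c) :
    c = 0 ∧ (β ≠ 0 → ∀ u v w, algCurvature br nab u v w = 0) := by
  obtain ⟨n, e, hn, he, heJ⟩ := exists_unitaryFrame hd.inner_J hd.inner_J_left
  -- The factor 8 is −4 from the complexification times −2 from `inner_curvature`.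
  have key : ∀ u, ⟪u, u⟫_ℝ = 1 / 2 → β * (8 * holSec (dolbeault J br) u) = c := by
    intro u hu
    have := hmix n e hn he heJ u hu
    rw [← Finset.mul_sum, h.sum_inner_curvature hd hn e he heJ, h.inner_curvature hd] at this
    rw [holSec]
    linarith
  have hunit : ∀ u : V, u ≠ 0 → ⟪(√2 * ‖u‖)⁻¹ • u, (√2 * ‖u‖)⁻¹ • u⟫_ℝ = 1 / 2 := by
    intro u hu
    simp only [inner_smul_left, inner_smul_right, real_inner_self_eq_norm_sq, conj_trivial]
    have : ‖u‖ ≠ 0 := norm_ne_zero_iff.2 hu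
    field_simp
    norm_num
  by_cases hβ : β = 0
  · obtain ⟨u, hu⟩ := exists_ne (0 : V)
    have := key _ (hunit u hu)
    rw [hβ, zero_mul] at this
    exact ⟨this.symm, fun h ↦ absurd hβ h⟩
  have hscale : ∀ (t : ℝ) (u : V), holSec (dolbeault J br) (t • u)
      = t ^ 4 * holSec (dolbeault J br) u := by
    intro t u
    simp only [holSec, map_smul, LinearMap.smul_apply, norm_smul, inner_smul_left,
      inner_smul_right, conj_trivial, mul_pow, Real.norm_eq_abs, sq_abs]
    ring
  -- Rescaling to squared length 1/2 divides the quartic `holSec` by 4‖u‖⁴, so 8β becomes 2β.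
  have hall : ∀ u, holSec (dolbeault J br) u = (c / (2 * β)) * ‖u‖ ^ 4 := by
    intro u
    by_cases hu : u = 0
    · simp [hu, holSec]
    have := key _ (hunit u hu)
    rw [hscale] at this
    have hu' : ‖u‖ ≠ 0 := norm_ne_zero_iff.2 hu
    have h4 : (√2 : ℝ) ^ 4 = 4 := by
      rw [show (4 : ℕ) = 2 * 2 from rfl, pow_mul, Real.sq_sqrt (by norm_num)]; norm_num
    rw [inv_pow, mul_pow, h4] at this
    rw [← this]
    field_simp
    ring
  have hc : c = 0 := by
    have := hd.eq_zero_of_holSec_eq hall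
    simpa [hβ] using this
  refine ⟨hc, fun _ ↦ h.curvature_eq_zero hd hbr fun u ↦ ?_⟩
  rw [hall, hc]
  simp

end Inner

/-! ### From a nilpotent Lie algebra to the filtration -/

section Lie

variable {L : Type*} [LieRing L] [LieAlgebra ℝ L]

/-- The bracket of a Lie algebra as a bilinear map. -/
def lieBilin (L : Type*) [LieRing L] [LieAlgebra ℝ L] : L →ₗ[ℝ] L →ₗ[ℝ] L :=
  LinearMap.mk₂ ℝ (fun x y ↦ ⁅x, y⁆) add_lie smul_lie lie_add lie_smul

theorem lieBilin_apply (x y : L) : lieBilin L x y = ⁅x, y⁆ := rfl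

/-- Take F k = C k + J C k with C the lower central series of N. Adding J C k makes the steps
complex; as N is J-stable, both [u, x] and [Ju, x] descend for u ∈ N. -/
theorem exists_filtration {J : L →ₗ[ℝ] L} {N : LieSubalgebra ℝ L} (hJJ : ∀ u, J (J u) = -u)
    (hJ : ∀ u v, dolbeault J (lieBilin L) u (J v) = J (dolbeault J (lieBilin L) u v))
    (hNJ : ∀ x ∈ N, J x ∈ N) (hnil : LieRing.IsNilpotent N) :
    ∃ (F : ℕ → Submodule ℝ L) (m : ℕ), F 0 = N.toSubmodule ∧ F m = ⊥ ∧
      ∀ k, ∀ u ∈ N, ∀ v ∈ F k, dolbeault J (lieBilin L) u v ∈ F (k + 1) := by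
  obtain ⟨m, hm⟩ := (LieModule.isNilpotent_iff ℝ N N).1 hnil
  let C : ℕ → Submodule ℝ L := fun k ↦
    (LieModule.lowerCentralSeries ℝ N N k).toSubmodule.map N.toSubmodule.subtype
  have hC : ∀ k, ∀ u ∈ N, ∀ v ∈ C k, ⁅u, v⁆ ∈ C (k + 1) := by
    rintro k u hu _ ⟨v, hv, rfl⟩
    refine ⟨⁅(⟨u, hu⟩ : N), v⁆, ?_, rfl⟩
    rw [LieModule.lowerCentralSeries_succ]
    exact LieSubmodule.lie_mem_lie (LieSubmodule.mem_top _) hv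
  refine ⟨fun k ↦ C k ⊔ (C k).map J, m, ?_, ?_, ?_⟩
  · have h0 : C 0 = N.toSubmodule := by
      simp [C]
    simp only [h0, sup_eq_left]
    rintro _ ⟨x, hx, rfl⟩
    exact hNJ x hx
  · simp [C, hm]
  · intro k u hu v hv
    obtain ⟨x, hx, _, ⟨y, hy, rfl⟩, rfl⟩ := Submodule.mem_sup.1 hv
    have key : ∀ x ∈ C k, dolbeault J (lieBilin L) u x ∈ C (k + 1) ⊔ (C (k + 1)).map J := by
      intro x hx
      rw [dolbeault_apply]
      exact Submodule.smul_mem _ _ (Submodule.add_mem_sup (hC k u hu x hx)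
        (Submodule.mem_map_of_mem (hC k _ (hNJ u hu) x hx)))
    have key' : ∀ z ∈ C (k + 1) ⊔ (C (k + 1)).map J, J z ∈ C (k + 1) ⊔ (C (k + 1)).map J := by
      intro z hz
      obtain ⟨x, hx, _, ⟨y, hy, rfl⟩, rfl⟩ := Submodule.mem_sup.1 hz
      rw [map_add, hJJ, add_comm (J x)]
      exact Submodule.add_mem_sup (Submodule.neg_mem _ hy) (Submodule.mem_map_of_mem hx)
    rw [map_add, hJ]
    exact Submodule.add_mem _ (key x hx) (key' _ (key y hy))

theorem mixed_curvature [FiniteDimensional ℝ L] [Nontrivial L] {g : L →ₗ[ℝ] L →ₗ[ℝ] ℝ}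
    {J : L →ₗ[ℝ] L} {nab : L →ₗ[ℝ] L →ₗ[ℝ] L} (h : IsChernAlgebra g J (lieBilin L) nab)
    {N : LieSubalgebra ℝ L} (hNJ : ∀ x ∈ N, J x ∈ N) (hN : ∀ x y : L, ⁅x, y⁆ ∈ N)
    (hnil : LieRing.IsNilpotent N) {α β c : ℝ}
    (hmix : ∀ (n : ℕ) (e : Fin n → L), Module.finrank ℝ L = 2 * n →
      (∀ i j, g (e i) (e j) = if i = j then 1 / 2 else 0) → (∀ i j, g (e i) (J (e j)) = 0) →
      ∀ u, g u u = 1 / 2 →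
        α * ∑ i, -4 * g (algCurvature (lieBilin L) nab u (J u) (e i)) (J (e i))
          + β * (-4 * g (algCurvature (lieBilin L) nab u (J u) u) (J u)) = c) :
    c = 0 ∧ (β ≠ 0 → ∀ u v w, algCurvature (lieBilin L) nab u v w = 0) := by
  let core : InnerProductSpace.Core ℝ L :=
    { inner := fun u v ↦ g u v
      conj_inner_symm := fun u v ↦ h.symm v u
      re_inner_nonneg := fun u ↦ by
        by_cases hu : u = 0
        · simp [hu]
        · exact (h.pos u hu).le
      add_left := fun u v w ↦ by simp
      smul_left := fun u v r ↦ by simp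
      definite := fun u hu ↦ by
        by_contra hne
        exact (h.pos u hne).ne' hu }
  let : NormedAddCommGroup L := core.toNormedAddCommGroup
  let : InnerProductSpace ℝ L := InnerProductSpace.ofCore core.toCore
  have hg : g = innerₗ L := by
    ext u v
    rfl
  have h' : IsChernAlgebra (innerₗ L) J (lieBilin L) nab := hg ▸ h
  obtain ⟨F, m, hF0, hFm, hF⟩ := exists_filtration h.J_J h.dolbeault_J_right hNJ hnil
  have hd : IsNilpotentDolbeault J (dolbeault J (lieBilin L)) N.toSubmodule F m :=
    { J_J := h.J_J
      inner_J := h.metric_J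
      J_left := h.dolbeault_J_left
      J_right := h.dolbeault_J_right
      J_mem := hNJ
      mem := fun u v ↦ by
        rw [dolbeault_apply]
        exact N.toSubmodule.smul_mem _ (N.toSubmodule.add_mem (hN u v) (hNJ _ (hN _ _)))
      zero := hF0
      last := hFm
      step := hF }
  exact h'.mixed_curvature_inner hd hN hmix

end Lie

end IsChernAlgebra

end ChernAlgebra

end

noncomputable section

/-! ### Left-invariant frames on the quotient -/

section LieFrame

variable {E : Type*} [NormedAddCommGroup E] [NormedSpace ℝ E] [FiniteDimensional ℝ E]
  {M : Type*} [TopologicalSpace M] [ChartedSpace E M] [IsManifold 𝓘(ℝ, E) ∞ M]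

/-- A frame of vector fields near `x`, indexed by a Lie algebra `L`, in which the bracket, the metric
and the complex structure are constant. -/
structure LieFrame (h : HermitianStructure E M) (L : Type*) [LieRing L] [LieAlgebra ℝ L]
    (g : L →ₗ[ℝ] L →ₗ[ℝ] ℝ) (J : L →ₗ[ℝ] L) (x : M) where
  /-- the domain of the frame -/
  dom : Set M
  isOpen_dom : IsOpen dom
  mem_dom : x ∈ dom
  /-- the fields of the frame -/
  fld : L →ₗ[ℝ] (∀ y : M, TangentSpace 𝓘(ℝ, E) y)
  bijective : ∀ y ∈ dom, Function.Bijective fun X ↦ fld X y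
  contMDiffAt : ∀ X, ∀ y ∈ dom, CMDiffAt 2 (T% (fld X)) y
  bracket : ∀ X Y, ∀ y ∈ dom, mlieBracket 𝓘(ℝ, E) (fld X) (fld Y) y = fld ⁅X, Y⁆ y
  metric : ∀ X Y, ∀ y ∈ dom, h.metric.inner y (fld X y) (fld Y y) = g X Y
  J_fld : ∀ X, ∀ y ∈ dom, h.J y (fld X y) = fld (J X) y

end LieFrame

section Construction

variable {E : Type*} [NormedAddCommGroup E] [NormedSpace ℝ E]
  {G : Type*} [TopologicalSpace G] [ChartedSpace E G] [Group G] [LieGroup 𝓘(ℝ, E) ∞ G]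
  {M : Type*} [TopologicalSpace M] [ChartedSpace E M] [IsManifold 𝓘(ℝ, E) ∞ M]

/-- The metric of a Hermitian structure on the Lie group `G`, on the Lie algebra. -/
def HermitianStructure.lieMetric (h : HermitianStructure E G) :
    GroupLieAlgebra 𝓘(ℝ, E) G →ₗ[ℝ] GroupLieAlgebra 𝓘(ℝ, E) G →ₗ[ℝ] ℝ :=
  LinearMap.mk₂ ℝ (fun u v ↦ h.metric.inner (1 : G) u v) (by simp) (by simp) (by simp) (by simp)

/-- The complex structure of a Hermitian structure on the Lie group `G`, on the Lie algebra. -/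
def HermitianStructure.lieJ (h : HermitianStructure E G) :
    GroupLieAlgebra 𝓘(ℝ, E) G →ₗ[ℝ] GroupLieAlgebra 𝓘(ℝ, E) G :=
  (h.J 1 : GroupLieAlgebra 𝓘(ℝ, E) G →ₗ[ℝ] GroupLieAlgebra 𝓘(ℝ, E) G)

theorem HermitianStructure.IsLeftInvariant.metric_mulInvariantVectorField
    {h : HermitianStructure E G} (hl : h.IsLeftInvariant) (X Y : GroupLieAlgebra 𝓘(ℝ, E) G)
    (a : G) : h.metric.inner a (mulInvariantVectorField X a) (mulInvariantVectorField Y a)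
      = h.lieMetric X Y := by
  have := hl.metric a 1 X Y
  rw [mul_one] at this
  exact this

theorem HermitianStructure.IsLeftInvariant.J_mulInvariantVectorField
    {h : HermitianStructure E G} (hl : h.IsLeftInvariant) (X : GroupLieAlgebra 𝓘(ℝ, E) G)
    (a : G) : h.J a (mulInvariantVectorField X a) = mulInvariantVectorField (h.lieJ X) a := by
  have := hl.J a 1 X
  rw [mul_one] at this
  exact this

theorem bijective_mulInvariantVectorField (a : G) :
    Function.Bijective fun X : GroupLieAlgebra 𝓘(ℝ, E) G ↦ mulInvariantVectorField X a := by
  have hd : ∀ b c : G, MDifferentiableAt 𝓘(ℝ, E) 𝓘(ℝ, E) (fun y : G ↦ b * y) c := fun b c ↦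
    (contMDiff_mul_left (I := 𝓘(ℝ, E)) (n := ∞)).contMDiffAt.mdifferentiableAt (by simp)
  have h1 : ∀ (b c : G) (v : E), mfderiv 𝓘(ℝ, E) 𝓘(ℝ, E) (fun y : G ↦ b⁻¹ * y) (b * c)
      (mfderiv 𝓘(ℝ, E) 𝓘(ℝ, E) (fun y : G ↦ b * y) c v) = v := by
    intro b c v
    have h2 := mfderiv_comp c (hd b⁻¹ (b * c)) (hd b c)
    have h3 : (fun y : G ↦ b⁻¹ * y) ∘ (fun y ↦ b * y) = id := by ext; simp
    rw [h3, mfderiv_id] at h2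
    exact (DFunLike.congr_fun h2 v).symm
  refine ⟨fun X Y hXY ↦ ?_, fun v ↦ ?_⟩
  · have hX := h1 a 1 X
    have hY := h1 a 1 Y
    exact hX.symm.trans ((congrArg (mfderiv 𝓘(ℝ, E) 𝓘(ℝ, E) (fun y : G ↦ a⁻¹ * y) (a * 1))
      hXY).trans hY)
  · have := h1 a⁻¹ a v
    rw [inv_inv] at this
    rw [show a⁻¹ * a = 1 from inv_mul_cancel a] at this
    exact ⟨_, this⟩

/-- The left-invariant vector fields on `G`, transported to `M` by a local inverse `σ` of the
covering. -/
def transportedFields (σ : M → G) :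
    GroupLieAlgebra 𝓘(ℝ, E) G →ₗ[ℝ] (∀ y : M, TangentSpace 𝓘(ℝ, E) y) where
  toFun X := mpullback 𝓘(ℝ, E) 𝓘(ℝ, E) σ (mulInvariantVectorField X)
  map_add' X Y := by rw [mulInvariantVectorField_add, mpullback_add]
  map_smul' c X := by rw [mulInvariantVectorField_smul, mpullback_const_smul]; rfl

variable [FiniteDimensional ℝ E]

/-- Left-invariant fields are carried to M by a local inverse σ of the covering. Pullback by σ
preserves brackets, and p preserves the metric and J. -/
theorem exists_lieFrame {hG : HermitianStructure E G} {Γ : Subgroup G}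
    {hM : HermitianStructure E M} {p : G → M} (hLH : IsLieHermitian hG Γ hM p) (x : M) :
    Nonempty (LieFrame hM (GroupLieAlgebra 𝓘(ℝ, E) G) hG.lieMetric hG.lieJ x) := by
  obtain ⟨a, rfl⟩ := hLH.surjective x
  obtain ⟨Φ, ha, hΦ⟩ := hLH.localDiffeo a
  let σ : M → G := Φ.symm.toFun
  have hσp : ∀ b ∈ Φ.source, σ (p b) = b := fun b hb ↦ by rw [hΦ hb]; exact Φ.left_inv hb
  have hpσ : ∀ y ∈ Φ.target, p (σ y) = y := fun y hy ↦
    (hΦ (Φ.map_target hy)).trans (Φ.right_inv hy)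
  have hmem : ∀ y ∈ Φ.target, ∃ b ∈ Φ.source, p b = y := fun y hy ↦
    ⟨σ y, Φ.map_target hy, hpσ y hy⟩
  have hpt : ∀ b ∈ Φ.source, p b ∈ Φ.target := fun b hb ↦ by rw [hΦ hb]; exact Φ.map_source hb
  have hσC : ∀ y ∈ Φ.target, ContMDiffAt 𝓘(ℝ, E) 𝓘(ℝ, E) ∞ σ y := fun y hy ↦
    Φ.symm.contMDiffOn.contMDiffAt (Φ.open_target.mem_nhds hy)
  have hσd : ∀ y ∈ Φ.target, MDifferentiableAt 𝓘(ℝ, E) 𝓘(ℝ, E) σ y := fun y hy ↦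
    (hσC y hy).mdifferentiableAt (by simp)
  have hpd : ∀ b, MDifferentiableAt 𝓘(ℝ, E) 𝓘(ℝ, E) p b := fun b ↦
    hLH.localDiffeo.mdifferentiable (by simp) b
  have hinv : ∀ y ∈ Φ.target, (mfderiv 𝓘(ℝ, E) 𝓘(ℝ, E) σ y).IsInvertible := by
    intro y hy
    have : IsLocalDiffeomorphAt 𝓘(ℝ, E) 𝓘(ℝ, E) ∞ σ y := ⟨Φ.symm, hy, fun _ _ ↦ rfl⟩
    exact ⟨this.mfderivToContinuousLinearEquiv (by simp), rfl⟩
  have hcomp : ∀ b ∈ Φ.source, ∀ v : E, mfderiv 𝓘(ℝ, E) 𝓘(ℝ, E) σ (p b)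
      (mfderiv 𝓘(ℝ, E) 𝓘(ℝ, E) p b v) = v := by
    intro b hb v
    have h2 := mfderiv_comp b (hσd (p b) (hpt b hb)) (hpd b)
    have h3 : σ ∘ p =ᶠ[nhds b] id := by
      filter_upwards [Φ.open_source.mem_nhds hb] with c hc using hσp c hc
    rw [h3.mfderiv_eq, mfderiv_id] at h2
    exact (DFunLike.congr_fun h2 v).symm
  have hfld : ∀ (X : GroupLieAlgebra 𝓘(ℝ, E) G), ∀ b ∈ Φ.source, transportedFields σ X (p b)
      = mfderiv 𝓘(ℝ, E) 𝓘(ℝ, E) p b (mulInvariantVectorField X b) := by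
    intro X b hb
    have h1 := (hinv (p b) (hpt b hb)).inverse_apply_eq
      (x := mfderiv 𝓘(ℝ, E) 𝓘(ℝ, E) p b (mulInvariantVectorField X b))
      (y := mulInvariantVectorField X (σ (p b)))
    refine h1.2 ?_
    have h2 : ∀ c : G, c = b → (mulInvariantVectorField X c : E) = mulInvariantVectorField X b := by
      rintro c rfl; rfl
    exact (h2 _ (hσp b hb)).trans (hcomp b hb _).symm
  have hbij : ∀ b, Function.Bijective (mfderiv 𝓘(ℝ, E) 𝓘(ℝ, E) p b) := fun b ↦
    ((hLH.localDiffeo b).mfderivToContinuousLinearEquiv (by simp)).bijective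
  refine ⟨{ dom := Φ.target
            isOpen_dom := Φ.open_target
            mem_dom := hpt a ha
            fld := transportedFields σ
            bijective := ?_
            contMDiffAt := ?_
            bracket := ?_
            metric := ?_
            J_fld := ?_ }⟩
  · intro y hy
    obtain ⟨b, hb, rfl⟩ := hmem y hy
    simp_rw [hfld _ b hb]
    exact (hbij b).comp (bijective_mulInvariantVectorField b)
  · intro X y hy
    have h1 := contMDiffAt_mulInvariantVectorField (𝕜 := ℝ) (I := 𝓘(ℝ, E)) X (g := σ y)
    have h2 := h1.of_le (m := 2) (minSmoothness_of_isRCLikeNormedField (𝕜 := ℝ)).ge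
    exact ContMDiffAt.mpullback_vectorField_preimage h2 (hσC y hy) (hinv y hy) (by norm_cast)
  · intro X Y y hy
    have h1 := mpullback_mlieBracket (V := mulInvariantVectorField X)
      (W := mulInvariantVectorField Y) (mdifferentiableAt_mulInvariantVectorField X)
      (mdifferentiableAt_mulInvariantVectorField Y) (hσC y hy)
      (by rw [minSmoothness_of_isRCLikeNormedField]; norm_cast)
    rw [← mulInvariantVector_mlieBracket] at h1
    exact h1.symm
  · intro X Y y hy
    obtain ⟨b, hb, rfl⟩ := hmem y hy
    rw [hfld X b hb, hfld Y b hb, hLH.metric, hLH.leftInvariant.metric_mulInvariantVectorField]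
  · intro X y hy
    obtain ⟨b, hb, rfl⟩ := hmem y hy
    rw [hfld X b hb, hfld _ b hb, hLH.J, hLH.leftInvariant.J_mulInvariantVectorField]

end Construction

end

noncomputable section

/-! ### The Chern connection in a frame -/

namespace LieFrame

open Filter Topology

theorem mvfderiv_apply_eq_zero {E : Type*} [NormedAddCommGroup E] [NormedSpace ℝ E]
    {M : Type*} [TopologicalSpace M] [ChartedSpace E M]
    {φ : M → ℝ} {c : ℝ} {y : M} (hφ : φ =ᶠ[𝓝 y] fun _ ↦ c)
    (v : TangentSpace 𝓘(ℝ, E) y) : d% φ y v = 0 := by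
  have h1 : HasMFDerivAt 𝓘(ℝ, E) 𝓘(ℝ, ℝ) φ y 0 :=
    (hasMFDerivAt_const c y).congr_of_eventuallyEq hφ
  simp [mvfderiv, h1.mfderiv]

variable {E : Type*} [NormedAddCommGroup E] [NormedSpace ℝ E]
  {M : Type*} [TopologicalSpace M] [ChartedSpace E M] [IsManifold 𝓘(ℝ, E) ∞ M]
  {h : HermitianStructure E M} {L : Type*} [LieRing L] [LieAlgebra ℝ L]
  {g : L →ₗ[ℝ] L →ₗ[ℝ] ℝ} {J : L →ₗ[ℝ] L} {x : M}
  {D : CovariantDerivative 𝓘(ℝ, E) E (fun x : M ↦ TangentSpace 𝓘(ℝ, E) x)}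

theorem eventually_dom (f : LieFrame h L g J x) {y : M} (hy : y ∈ f.dom) :
    ∀ᶠ z in 𝓝 y, z ∈ f.dom :=
  f.isOpen_dom.mem_nhds hy

theorem mdiffAt (f : LieFrame h L g J x) (X : L) {y : M} (hy : y ∈ f.dom) :
    MDiffAt (T% (f.fld X)) y :=
  (f.contMDiffAt X y hy).mdifferentiableAt (by simp)

/-- The frame as a linear equivalence at a point of its domain. -/
def equivAt (f : LieFrame h L g J x) {y : M} (hy : y ∈ f.dom) :
    L ≃ₗ[ℝ] TangentSpace 𝓘(ℝ, E) y :=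
  LinearEquiv.ofBijective
    { toFun := fun X ↦ f.fld X y
      map_add' := fun X Y ↦ by rw [map_add, Pi.add_apply]
      map_smul' := fun c X ↦ by rw [map_smul, Pi.smul_apply, RingHom.id_apply] }
    (f.bijective y hy)

variable (D) in
/-- The connection at `y` in the frame. -/
def nabAt (f : LieFrame h L g J x) {y : M} (hy : y ∈ f.dom) : L →ₗ[ℝ] L →ₗ[ℝ] L :=
  LinearMap.mk₂ ℝ (fun X Y ↦ (f.equivAt hy).symm (D (f.fld Y) y (f.fld X y)))
    (fun X X' Y ↦ by rw [map_add, Pi.add_apply, map_add, map_add])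
    (fun c X Y ↦ by rw [map_smul, Pi.smul_apply, map_smul, map_smul])
    (fun X Y Y' ↦ by
      rw [map_add, D.isCovariantDerivativeOn.add (f.mdiffAt Y hy) (f.mdiffAt Y' hy)
        (Set.mem_univ y), add_apply, map_add])
    (fun c X Y ↦ by
      rw [map_smul, D.isCovariantDerivativeOn.smul_const c (f.mdiffAt Y hy) (Set.mem_univ y),
        smul_apply, map_smul])

theorem fld_nabAt (f : LieFrame h L g J x) {y : M} (hy : y ∈ f.dom) (X Y : L) :
    f.fld (f.nabAt D hy X Y) y = D (f.fld Y) y (f.fld X y) :=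
  (f.equivAt hy).apply_symm_apply _

theorem fld_injective (f : LieFrame h L g J x) {y : M} (hy : y ∈ f.dom) {X Y : L}
    (hXY : f.fld X y = f.fld Y y) : X = Y :=
  (f.bijective y hy).1 hXY

theorem J_fld_eventuallyEq (f : LieFrame h L g J x) {y : M} (hy : y ∈ f.dom) (X : L) :
    (fun z ↦ h.J z (f.fld X z)) =ᶠ[𝓝 y] f.fld (J X) := by
  filter_upwards [f.eventually_dom hy] with z hz using f.J_fld X z hz

theorem mdiffAt_congr {V V' : ∀ y : M, TangentSpace 𝓘(ℝ, E) y} {y : M} (hV : MDiffAt (T% V) y)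
    (hVV' : V' =ᶠ[𝓝 y] V) : MDiffAt (T% V') y :=
  hV.congr_of_eventuallyEq (hVV'.mono fun z hz ↦ by simp only [hz])

variable [FiniteDimensional ℝ E]

/-- The Chern connection is the algebraic Chern connection in the frame. -/
theorem isChernAlgebra (f : LieFrame h L g J x) (hD : IsChernConnection h D) {y : M}
    (hy : y ∈ f.dom) : IsChernAlgebra g J (IsChernAlgebra.lieBilin L) (f.nabAt D hy) where
  symm u v := by rw [← f.metric u v y hy, ← f.metric v u y hy, h.metric.symm]
  pos u hu := by
    rw [← f.metric u u y hy]
    refine h.metric.pos y _ fun h0 ↦ hu (f.fld_injective hy ?_)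
    rw [h0, map_zero, Pi.zero_apply]
  J_J u := by
    refine f.fld_injective hy ?_
    rw [← f.J_fld _ y hy, ← f.J_fld _ y hy, h.J_J, map_neg, Pi.neg_apply]
  metric_J u v := by
    rw [← f.metric _ _ y hy, ← f.metric u v y hy, ← f.J_fld _ y hy, ← f.J_fld _ y hy, h.metric_J]
  skew u v := (lie_skew u v).symm
  jacobi u v w := leibniz_lie u v w
  integrable u v := by
    have := h.integrable y _ _ (f.mdiffAt u hy) (f.mdiffAt v hy)
    have hv : f.fld v =ᶠ[𝓝 y] f.fld v := EventuallyEq.rfl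
    have hu : f.fld u =ᶠ[𝓝 y] f.fld u := EventuallyEq.rfl
    rw [(f.J_fld_eventuallyEq hy u).mlieBracket_vectorField_eq (f.J_fld_eventuallyEq hy v),
      (f.J_fld_eventuallyEq hy u).mlieBracket_vectorField_eq hv,
      hu.mlieBracket_vectorField_eq (f.J_fld_eventuallyEq hy v),
      f.bracket _ _ y hy, f.bracket _ _ y hy, f.bracket _ _ y hy, f.bracket _ _ y hy,
      f.J_fld _ y hy, f.J_fld _ y hy] at this
    refine f.fld_injective hy ?_
    simpa only [IsChernAlgebra.lieBilin_apply, map_add, map_sub, map_zero, Pi.add_apply,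
      Pi.sub_apply, Pi.zero_apply] using this
  metric u v w := by
    have := hD.metric y _ _ (f.mdiffAt v hy) (f.mdiffAt w hy) (f.fld u y)
    have hc : (fun z ↦ h.metric.inner z (f.fld v z) (f.fld w z)) =ᶠ[𝓝 y] fun _ ↦ g v w := by
      filter_upwards [f.eventually_dom hy] with z hz using f.metric v w z hz
    rw [mvfderiv_apply_eq_zero hc, ← f.fld_nabAt hy, ← f.fld_nabAt hy,
      f.metric (f.nabAt D hy u v) w y hy, f.metric v (f.nabAt D hy u w) y hy] at this
    exact this.symm
  parallel_J u v := by
    have := hD.parallel_J y _ (f.mdiffAt v hy) (f.fld u y)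
    rw [D.isCovariantDerivativeOn.congr_of_eventuallyEq
      (mdiffAt_congr (f.mdiffAt (J v) hy) (f.J_fld_eventuallyEq hy v)) (f.mdiffAt (J v) hy)
      univ_mem (f.J_fld_eventuallyEq hy v), ← f.fld_nabAt hy, ← f.fld_nabAt hy,
      f.J_fld _ y hy] at this
    exact f.fld_injective hy this
  torsion_J u v := by
    have := hD.torsion_J y (f.fld u y) (f.fld v y)
    rw [f.J_fld _ y hy, f.J_fld _ y hy, D.torsion_apply (f.mdiffAt _ hy) (f.mdiffAt _ hy),
      D.torsion_apply (f.mdiffAt _ hy) (f.mdiffAt _ hy), ← f.fld_nabAt hy, ← f.fld_nabAt hy,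
      ← f.fld_nabAt hy, ← f.fld_nabAt hy, f.bracket _ _ y hy, f.bracket _ _ y hy] at this
    refine f.fld_injective hy ?_
    simpa only [IsChernAlgebra.lieBilin_apply, map_neg, map_sub, Pi.neg_apply, Pi.sub_apply] using this

variable (D) in
/-- The connection in the frame. -/
def nab (f : LieFrame h L g J x) : L →ₗ[ℝ] L →ₗ[ℝ] L := f.nabAt D f.mem_dom

/-- At every point the coefficients form an algebraic Chern connection for the same data, so by
uniqueness they do not depend on the point. -/
theorem apply_fld (f : LieFrame h L g J x) (hD : IsChernConnection h D) {y : M}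
    (hy : y ∈ f.dom) (X Y : L) : D (f.fld Y) y (f.fld X y) = f.fld (f.nab D X Y) y := by
  rw [← f.fld_nabAt hy, nab, (f.isChernAlgebra hD f.mem_dom).unique (f.isChernAlgebra hD hy)]

end LieFrame

end

noncomputable section

/-! ### Derivatives of functions along the frame -/

namespace LieFrame

open Filter Topology

variable {E : Type*} [NormedAddCommGroup E] [NormedSpace ℝ E]
  {M : Type*} [TopologicalSpace M] [ChartedSpace E M] [IsManifold 𝓘(ℝ, E) ∞ M]
  {h : HermitianStructure E M} {L : Type*} [LieRing L] [LieAlgebra ℝ L]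
  {g : L →ₗ[ℝ] L →ₗ[ℝ] ℝ} {J : L →ₗ[ℝ] L} {x : M}
  {D : CovariantDerivative 𝓘(ℝ, E) E (fun x : M ↦ TangentSpace 𝓘(ℝ, E) x)}

theorem pos (f : LieFrame h L g J x) {u : L} (hu : u ≠ 0) : 0 < g u u := by
  rw [← f.metric u u x f.mem_dom]
  refine h.metric.pos x _ fun h0 ↦ hu (f.fld_injective f.mem_dom ?_)
  rw [h0, map_zero, Pi.zero_apply]

theorem contMDiffAt_metric {n : ℕ∞} (h : HermitianStructure E M)
    {V W : ∀ y : M, TangentSpace 𝓘(ℝ, E) y} {y : M}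
    (hV : CMDiffAt n (T% V) y) (hW : CMDiffAt n (T% W) y) :
    ContMDiffAt 𝓘(ℝ, E) 𝓘(ℝ, ℝ) n (fun z ↦ h.metric.inner z (V z) (W z)) y := by
  have h1 : ContMDiffAt 𝓘(ℝ, E) (𝓘(ℝ, E).prod 𝓘(ℝ, E →L[ℝ] E →L[ℝ] ℝ)) n
      (fun b ↦ TotalSpace.mk' (E →L[ℝ] E →L[ℝ] ℝ) b (h.metric.inner b)) y :=
    (h.metric.contMDiff y).of_le (by exact_mod_cast le_top)
  have h2 : ContMDiffAt 𝓘(ℝ, E) (𝓘(ℝ, E).prod 𝓘(ℝ, ℝ)) n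
      (fun z ↦ TotalSpace.mk' ℝ (E := Bundle.Trivial M ℝ) z (h.metric.inner z (V z) (W z))) y :=
    ContMDiffAt.clm_bundle_apply₂ (F₁ := E) (F₂ := E) h1 hV hW
  exact (contMDiffAt_section _).1 h2

theorem mdiffAt_metric (h : HermitianStructure E M)
    {V W : ∀ y : M, TangentSpace 𝓘(ℝ, E) y} {y : M}
    (hV : MDiffAt (T% V) y) (hW : MDiffAt (T% W) y) :
    MDiffAt (fun z ↦ h.metric.inner z (V z) (W z)) y := by
  have h1 : MDifferentiableAt 𝓘(ℝ, E) (𝓘(ℝ, E).prod 𝓘(ℝ, E →L[ℝ] E →L[ℝ] ℝ))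
      (fun b ↦ TotalSpace.mk' (E →L[ℝ] E →L[ℝ] ℝ) b (h.metric.inner b)) y :=
    (h.metric.contMDiff y).mdifferentiableAt (by simp)
  have h2 : MDifferentiableAt 𝓘(ℝ, E) (𝓘(ℝ, E).prod 𝓘(ℝ, ℝ))
      (fun z ↦ TotalSpace.mk' ℝ (E := Bundle.Trivial M ℝ) z (h.metric.inner z (V z) (W z))) y :=
    MDifferentiableAt.clm_bundle_apply₂ (F₁ := E) (F₂ := E) h1 hV hW
  exact (mdifferentiableAt_section _ _).1 h2

/-- The derivative of `φ` along the frame field `X`. -/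
def lieDeriv (f : LieFrame h L g J x) (X : L) (φ : M → ℝ) (y : M) : ℝ := d% φ y (f.fld X y)

theorem eventually_mdiffAt {φ : M → ℝ} (hφ : ContMDiffAt 𝓘(ℝ, E) 𝓘(ℝ, ℝ) 2 φ x) :
    ∀ᶠ y in 𝓝 x, MDiffAt φ y :=
  ((contMDiffAt_iff_contMDiffAt_nhds (by simp)).1 hφ).mono fun _ hy ↦ hy.mdifferentiableAt (by simp)

variable [FiniteDimensional ℝ E]

theorem bracket_smul (f : LieFrame h L g J x) {φ : M → ℝ} {y : M} (hy : y ∈ f.dom)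
    (hφ : MDiffAt φ y) (X W : L) :
    mlieBracket 𝓘(ℝ, E) (f.fld X) (φ • f.fld W) y
      = f.lieDeriv X φ y • f.fld W y + φ y • f.fld ⁅X, W⁆ y := by
  rw [mlieBracket_smul_right hφ (f.mdiffAt W hy), f.bracket _ _ y hy]
  rfl

/-- The derivative Xφ is read off from the differentiable field [X, φw] by pairing with w, since [X,
φw] = (Xφ)w + φ[X, w]. -/
theorem mdiffAt_lieDeriv [Nontrivial L] (f : LieFrame h L g J x) {φ : M → ℝ}
    (hφ : ContMDiffAt 𝓘(ℝ, E) 𝓘(ℝ, ℝ) 2 φ x) (X : L) : MDiffAt (f.lieDeriv X φ) x := by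
  obtain ⟨w, hw⟩ := exists_ne (0 : L)
  have hgw := (f.pos hw).ne'
  have hsm : CMDiffAt 2 (T% (φ • f.fld w)) x := hφ.smul_section (f.contMDiffAt w x f.mem_dom)
  have : IsManifold 𝓘(ℝ, E) ((2 : ℕ∞) + 1) M := IsManifold.of_le (n := ∞) (by norm_cast)
  have hbr : CMDiffAt 1 (T% (mlieBracket 𝓘(ℝ, E) (f.fld X) (φ • f.fld w))) x :=
    ContMDiffAt.mlieBracket_vectorField (m := 1) (n := 2) (f.contMDiffAt X x f.mem_dom) hsm
      (by rw [minSmoothness_of_isRCLikeNormedField]; norm_cast)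
  have h1 := mdiffAt_metric h (hbr.mdifferentiableAt (by simp)) (f.mdiffAt w f.mem_dom)
  have h2 : MDiffAt (fun y ↦ (g w w)⁻¹ * (h.metric.inner y
      (mlieBracket 𝓘(ℝ, E) (f.fld X) (φ • f.fld w) y) (f.fld w y) - g ⁅X, w⁆ w * φ y)) x :=
    mdifferentiableAt_const.mul
      (h1.sub (mdifferentiableAt_const.mul (hφ.mdifferentiableAt (by simp))))
  refine h2.congr_of_eventuallyEq ?_
  filter_upwards [f.eventually_dom f.mem_dom, eventually_mdiffAt hφ] with y hy hφy
  rw [f.bracket_smul hy hφy, map_add, map_smul, map_smul, add_apply, smul_apply, smul_apply,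
    f.metric _ _ y hy, f.metric _ _ y hy, smul_eq_mul, smul_eq_mul]
  field_simp
  ring

/-- The commutator of the derivatives along frame fields. -/
theorem lieDeriv_commutator [Nontrivial L] (f : LieFrame h L g J x) {φ : M → ℝ}
    (hφ : ContMDiffAt 𝓘(ℝ, E) 𝓘(ℝ, ℝ) 2 φ x) (X Y : L) :
    f.lieDeriv X (f.lieDeriv Y φ) x - f.lieDeriv Y (f.lieDeriv X φ) x = f.lieDeriv ⁅X, Y⁆ φ x := by
  obtain ⟨w, hw⟩ := exists_ne (0 : L)
  have hw0 : f.fld w x ≠ 0 := fun h0 ↦ hw (f.fld_injective f.mem_dom (by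
    rw [h0, map_zero, Pi.zero_apply]))
  have hx := f.mem_dom
  have hφd : MDiffAt φ x := hφ.mdifferentiableAt (by simp)
  have hsm : CMDiffAt 2 (T% (φ • f.fld w)) x := hφ.smul_section (f.contMDiffAt w x f.mem_dom)
  have h2 : minSmoothness ℝ 2 = 2 := minSmoothness_of_isRCLikeNormedField
  -- The Jacobi identity for X, Y and φw: after the terms in φ and its first derivatives along X and
  -- Y cancel, the coefficient of w gives the commutator.
  have key := leibniz_identity_mlieBracket_apply (I := 𝓘(ℝ, E)) (U := f.fld X) (V := f.fld Y)
    (W := φ • f.fld w) (x := x) ((f.contMDiffAt X x hx).of_le h2.le)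
    ((f.contMDiffAt Y x hx).of_le h2.le) (hsm.of_le h2.le)
  have hev : ∀ Z : L, mlieBracket 𝓘(ℝ, E) (f.fld Z) (φ • f.fld w) =ᶠ[𝓝 x]
      f.lieDeriv Z φ • f.fld w + φ • f.fld ⁅Z, w⁆ := by
    intro Z
    filter_upwards [f.eventually_dom hx, eventually_mdiffAt hφ] with y hy hφy
    rw [f.bracket_smul hy hφy]
    rfl
  have hbr : mlieBracket 𝓘(ℝ, E) (f.fld X) (f.fld Y) =ᶠ[𝓝 x] f.fld ⁅X, Y⁆ := by
    filter_upwards [f.eventually_dom hx] with y hy using f.bracket X Y y hy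
  have hout : ∀ Z Z' : L, mlieBracket 𝓘(ℝ, E) (f.fld Z')
      (f.lieDeriv Z φ • f.fld w + φ • f.fld ⁅Z, w⁆) x =
      (f.lieDeriv Z' (f.lieDeriv Z φ) x • f.fld w x + f.lieDeriv Z φ x • f.fld ⁅Z', w⁆ x) +
      (f.lieDeriv Z' φ x • f.fld ⁅Z, w⁆ x + φ x • f.fld ⁅Z', ⁅Z, w⁆⁆ x) := by
    intro Z Z'
    have hd := f.mdiffAt_lieDeriv hφ Z
    rw [mlieBracket_add_right (hd.smul_section (f.mdiffAt w hx))
      (hφd.smul_section (f.mdiffAt _ hx)), f.bracket_smul hx hd, f.bracket_smul hx hφd]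
  have hrfl : ∀ Z : L, f.fld Z =ᶠ[𝓝 x] f.fld Z := fun _ ↦ EventuallyEq.rfl
  have hrfl' : φ • f.fld w =ᶠ[𝓝 x] φ • f.fld w := EventuallyEq.rfl
  rw [(hrfl X).mlieBracket_vectorField_eq (hev Y), (hrfl Y).mlieBracket_vectorField_eq (hev X),
    hbr.mlieBracket_vectorField_eq hrfl', f.bracket_smul hx hφd, hout, hout,
    leibniz_lie X Y w, map_add, Pi.add_apply] at key
  have : (f.lieDeriv X (f.lieDeriv Y φ) x - f.lieDeriv Y (f.lieDeriv X φ) x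
      - f.lieDeriv ⁅X, Y⁆ φ x) • f.fld w x = 0 := by
    linear_combination (norm := module) key
  exact sub_eq_zero.1 ((smul_eq_zero.1 this).resolve_right hw0)

end LieFrame

end

noncomputable section

/-! ### Curvature acting on fields with variable coefficients -/

namespace LieFrame

open Filter Topology

variable {E : Type*} [NormedAddCommGroup E] [NormedSpace ℝ E]
  {M : Type*} [TopologicalSpace M] [ChartedSpace E M] [IsManifold 𝓘(ℝ, E) ∞ M]
  {h : HermitianStructure E M} {L : Type*} [LieRing L] [LieAlgebra ℝ L]
  {g : L →ₗ[ℝ] L →ₗ[ℝ] ℝ} {J : L →ₗ[ℝ] L} {x : M}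
  {D : CovariantDerivative 𝓘(ℝ, E) E (fun x : M ↦ TangentSpace 𝓘(ℝ, E) x)}

variable (D) in
/-- The field `Z` is differentiable near `x`, and so are its covariant derivatives at `x`. -/
structure IsRegular (f : LieFrame h L g J x) (Z : ∀ y : M, TangentSpace 𝓘(ℝ, E) y) : Prop where
  eventually : ∀ᶠ y in 𝓝 x, MDiffAt (T% Z) y
  deriv : ∀ X : L, MDiffAt (T% (fun y ↦ D Z y (f.fld X y))) x

theorem apply_congr {V V' : ∀ y : M, TangentSpace 𝓘(ℝ, E) y} {y : M} (hV : MDiffAt (T% V) y)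
    (hVV' : V' =ᶠ[𝓝 y] V) : D V' y = D V y :=
  D.isCovariantDerivativeOn.congr_of_eventuallyEq (mdiffAt_congr hV hVV') hV univ_mem hVV'

theorem eventually_congr_deriv {Z Z' : ∀ y : M, TangentSpace 𝓘(ℝ, E) y}
    (hZ : ∀ᶠ y in 𝓝 x, MDiffAt (T% Z) y) (hZZ' : Z' =ᶠ[𝓝 x] Z) :
    ∀ᶠ y in 𝓝 x, D Z' y = D Z y := by
  filter_upwards [hZ, hZZ'.eventuallyEq_nhds] with y hy hy'
  exact D.isCovariantDerivativeOn.congr_of_eventuallyEq (mdiffAt_congr hy hy') hy univ_mem hy'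

theorem IsRegular.congr {f : LieFrame h L g J x} {Z Z' : ∀ y : M, TangentSpace 𝓘(ℝ, E) y}
    (hZ : f.IsRegular D Z) (hZZ' : Z' =ᶠ[𝓝 x] Z) : f.IsRegular D Z' where
  eventually := by
    filter_upwards [hZ.eventually, hZZ'.eventuallyEq_nhds] with y hy hy'
    exact mdiffAt_congr hy hy'
  deriv X := mdiffAt_congr (hZ.deriv X) (by
    filter_upwards [eventually_congr_deriv hZ.eventually hZZ'] with y hy
    rw [hy])

theorem isRegular_zero (f : LieFrame h L g J x) : f.IsRegular D 0 where
  eventually := Eventually.of_forall fun y ↦ mdifferentiableAt_zeroSection ..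
  deriv X := mdiffAt_congr (V := 0) (mdifferentiableAt_zeroSection ..)
    (Eventually.of_forall fun y ↦ by simp; rfl)

theorem IsRegular.add_deriv_eventuallyEq {f : LieFrame h L g J x}
    {Z Z' : ∀ y : M, TangentSpace 𝓘(ℝ, E) y} (hZ : f.IsRegular D Z) (hZ' : f.IsRegular D Z')
    (X : L) : (fun y ↦ D (Z + Z') y (f.fld X y)) =ᶠ[𝓝 x]
      (fun y ↦ D Z y (f.fld X y)) + fun y ↦ D Z' y (f.fld X y) := by
  filter_upwards [hZ.eventually, hZ'.eventually] with y hy hy'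
  rw [D.isCovariantDerivativeOn.add hy hy' (Set.mem_univ y)]
  rfl

theorem IsRegular.add {f : LieFrame h L g J x} {Z Z' : ∀ y : M, TangentSpace 𝓘(ℝ, E) y}
    (hZ : f.IsRegular D Z) (hZ' : f.IsRegular D Z') : f.IsRegular D (Z + Z') where
  eventually := by
    filter_upwards [hZ.eventually, hZ'.eventually] with y hy hy'
    exact mdifferentiableAt_add_section hy hy'
  deriv X := mdiffAt_congr (mdifferentiableAt_add_section (hZ.deriv X) (hZ'.deriv X))
    (hZ.add_deriv_eventuallyEq hZ' X)

theorem IsRegular.curvature_congr {f : LieFrame h L g J x}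
    {Z Z' : ∀ y : M, TangentSpace 𝓘(ℝ, E) y}
    (hZ : f.IsRegular D Z) (hZZ' : Z' =ᶠ[𝓝 x] Z) (X Y : L) :
    curvatureOfFields D (f.fld X) (f.fld Y) Z' x = curvatureOfFields D (f.fld X) (f.fld Y) Z x := by
  have hev := eventually_congr_deriv (D := D) hZ.eventually hZZ'
  have hW : ∀ W : L, (fun y ↦ D Z' y (f.fld W y)) =ᶠ[𝓝 x] fun y ↦ D Z y (f.fld W y) :=
    fun W ↦ hev.mono fun y hy ↦ DFunLike.congr_fun hy _
  rw [curvatureOfFields, curvatureOfFields, hev.self_of_nhds, apply_congr (hZ.deriv Y) (hW Y),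
    apply_congr (hZ.deriv X) (hW X)]

theorem IsRegular.curvature_add {f : LieFrame h L g J x}
    {Z Z' : ∀ y : M, TangentSpace 𝓘(ℝ, E) y}
    (hZ : f.IsRegular D Z) (hZ' : f.IsRegular D Z') (X Y : L) :
    curvatureOfFields D (f.fld X) (f.fld Y) (Z + Z') x =
      curvatureOfFields D (f.fld X) (f.fld Y) Z x
        + curvatureOfFields D (f.fld X) (f.fld Y) Z' x := by
  have hY := mdifferentiableAt_add_section (hZ.deriv Y) (hZ'.deriv Y)
  have hX := mdifferentiableAt_add_section (hZ.deriv X) (hZ'.deriv X)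
  have h1 := D.isCovariantDerivativeOn.add (hZ.deriv Y) (hZ'.deriv Y) (Set.mem_univ x)
  have h2 := D.isCovariantDerivativeOn.add (hZ.deriv X) (hZ'.deriv X) (Set.mem_univ x)
  have h3 := D.isCovariantDerivativeOn.add hZ.eventually.self_of_nhds
    hZ'.eventually.self_of_nhds (Set.mem_univ x)
  rw [curvatureOfFields, curvatureOfFields, curvatureOfFields, h3,
    apply_congr hY (hZ.add_deriv_eventuallyEq hZ' Y), h1,
    apply_congr hX (hZ.add_deriv_eventuallyEq hZ' X), h2, add_apply, add_apply, add_apply]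
  abel

section Smul

variable [FiniteDimensional ℝ E] {φ : M → ℝ}

theorem smul_deriv (f : LieFrame h L g J x) (hD : IsChernConnection h D) {y : M} (hy : y ∈ f.dom)
    (hφ : MDiffAt φ y) (X W : L) : D (φ • f.fld W) y (f.fld X y) =
      φ y • f.fld (f.nab D X W) y + f.lieDeriv X φ y • f.fld W y := by
  rw [D.isCovariantDerivativeOn.leibniz (f.mdiffAt W hy) hφ (Set.mem_univ y), add_apply,
    smul_apply, f.apply_fld hD hy]
  rfl

theorem smul_deriv_eventuallyEq (f : LieFrame h L g J x) (hD : IsChernConnection h D)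
    (hφ : ContMDiffAt 𝓘(ℝ, E) 𝓘(ℝ, ℝ) 2 φ x) (X W : L) :
    (fun y ↦ D (φ • f.fld W) y (f.fld X y)) =ᶠ[𝓝 x]
      φ • f.fld (f.nab D X W) + f.lieDeriv X φ • f.fld W := by
  filter_upwards [f.eventually_dom f.mem_dom, eventually_mdiffAt hφ] with y hy hφy
  rw [f.smul_deriv hD hy hφy]
  rfl

variable [Nontrivial L]

theorem mdiffAt_smul_deriv (f : LieFrame h L g J x)
    (hφ : ContMDiffAt 𝓘(ℝ, E) 𝓘(ℝ, ℝ) 2 φ x) (X V W : L) :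
    MDiffAt (T% (φ • f.fld V + f.lieDeriv X φ • f.fld W)) x :=
  mdifferentiableAt_add_section
    ((hφ.mdifferentiableAt (by simp)).smul_section (f.mdiffAt V f.mem_dom))
    ((f.mdiffAt_lieDeriv hφ X).smul_section (f.mdiffAt W f.mem_dom))

theorem isRegular_smul (f : LieFrame h L g J x) (hD : IsChernConnection h D)
    (hφ : ContMDiffAt 𝓘(ℝ, E) 𝓘(ℝ, ℝ) 2 φ x) (W : L) : f.IsRegular D (φ • f.fld W) where
  eventually := by
    filter_upwards [f.eventually_dom f.mem_dom, eventually_mdiffAt hφ] with y hy hφy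
    exact hφy.smul_section (f.mdiffAt W hy)
  deriv X := mdiffAt_congr (f.mdiffAt_smul_deriv hφ X _ W) (f.smul_deriv_eventuallyEq hD hφ X W)

/-- The first-derivative cross terms are symmetric in X and Y, and the second derivatives cancel
against the bracket term by `lieDeriv_commutator`. -/
theorem curvature_smul (f : LieFrame h L g J x) (hD : IsChernConnection h D)
    (hφ : ContMDiffAt 𝓘(ℝ, E) 𝓘(ℝ, ℝ) 2 φ x) (X Y W : L) :
    curvatureOfFields D (f.fld X) (f.fld Y) (φ • f.fld W) x =
      φ x • f.fld (algCurvature (IsChernAlgebra.lieBilin L) (f.nab D) X Y W) x := by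
  have hx := f.mem_dom
  have hφd : MDiffAt φ x := hφ.mdifferentiableAt (by simp)
  have hsecond : ∀ X Y : L, D (φ • f.fld (f.nab D Y W) + f.lieDeriv Y φ • f.fld W) x (f.fld X x) =
      (φ x • f.fld (f.nab D X (f.nab D Y W)) x + f.lieDeriv X φ x • f.fld (f.nab D Y W) x) +
      (f.lieDeriv Y φ x • f.fld (f.nab D X W) x
        + f.lieDeriv X (f.lieDeriv Y φ) x • f.fld W x) := by
    intro X Y
    have hd := f.mdiffAt_lieDeriv hφ Y
    rw [D.isCovariantDerivativeOn.add (hφd.smul_section (f.mdiffAt _ hx))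
      (hd.smul_section (f.mdiffAt W hx)) (Set.mem_univ x), add_apply, f.smul_deriv hD hx hφd,
      f.smul_deriv hD hx hd]
  rw [curvatureOfFields,
    apply_congr (f.mdiffAt_smul_deriv hφ Y _ W) (f.smul_deriv_eventuallyEq hD hφ Y W),
    apply_congr (f.mdiffAt_smul_deriv hφ X _ W) (f.smul_deriv_eventuallyEq hD hφ X W),
    hsecond, hsecond, f.bracket _ _ x hx, f.smul_deriv hD hx hφd, ← f.lieDeriv_commutator hφ,
    algCurvature, IsChernAlgebra.lieBilin_apply]
  simp only [map_sub, Pi.sub_apply]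
  module

end Smul

end LieFrame

end

noncomputable section

/-! ### Tensoriality and the pointwise curvature -/

namespace LieFrame

open Filter Topology

variable {E : Type*} [NormedAddCommGroup E] [NormedSpace ℝ E]
  {M : Type*} [TopologicalSpace M] [ChartedSpace E M] [IsManifold 𝓘(ℝ, E) ∞ M]
  {h : HermitianStructure E M} {L : Type*} [LieRing L] [LieAlgebra ℝ L]
  {g : L →ₗ[ℝ] L →ₗ[ℝ] ℝ} {J : L →ₗ[ℝ] L} {x : M}
  {D : CovariantDerivative 𝓘(ℝ, E) E (fun x : M ↦ TangentSpace 𝓘(ℝ, E) x)}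
  {ι : Type*}

theorem curvature_zero (f : LieFrame h L g J x) (X Y : L) :
    curvatureOfFields D (f.fld X) (f.fld Y) 0 x = 0 := by
  have := f.isRegular_zero (D := D).curvature_add f.isRegular_zero X Y
  simpa using this

section Sum

variable [FiniteDimensional ℝ E]

theorem isRegular_sum [Nontrivial L] (f : LieFrame h L g J x) (hD : IsChernConnection h D)
    (w : ι → L) {φ : ι → M → ℝ} (hφ : ∀ k, ContMDiffAt 𝓘(ℝ, E) 𝓘(ℝ, ℝ) 2 (φ k) x)
    (s : Finset ι) : f.IsRegular D (∑ k ∈ s, φ k • f.fld (w k)) := by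
  classical
  induction s using Finset.induction_on with
  | empty => rw [Finset.sum_empty]; exact f.isRegular_zero
  | insert a s ha ih => rw [Finset.sum_insert ha]; exact (f.isRegular_smul hD (hφ a) (w a)).add ih

theorem curvature_sum [Nontrivial L] (f : LieFrame h L g J x) (hD : IsChernConnection h D)
    (w : ι → L) {φ : ι → M → ℝ} (hφ : ∀ k, ContMDiffAt 𝓘(ℝ, E) 𝓘(ℝ, ℝ) 2 (φ k) x)
    (s : Finset ι) (X Y : L) :
    curvatureOfFields D (f.fld X) (f.fld Y) (∑ k ∈ s, φ k • f.fld (w k)) x = ∑ k ∈ s,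
      φ k x • f.fld (algCurvature (IsChernAlgebra.lieBilin L) (f.nab D) X Y (w k)) x := by
  classical
  induction s using Finset.induction_on with
  | empty => rw [Finset.sum_empty, Finset.sum_empty, f.curvature_zero]
  | insert a s ha ih =>
    rw [Finset.sum_insert ha, Finset.sum_insert ha,
      (f.isRegular_smul hD (hφ a) (w a)).curvature_add (f.isRegular_sum hD w hφ s), ih,
      f.curvature_smul hD (hφ a)]

end Sum

variable [Fintype ι]

/-- Coordinates become metric pairings with frame fields, so the coefficients of a vector field in
the frame inherit its regularity. -/
theorem exists_dual (f : LieFrame h L g J x) (b : Module.Basis ι ℝ L) :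
    ∃ v : ι → L, ∀ k W, g (v k) W = b.repr W k := by
  classical
  have : FiniteDimensional ℝ L := b.finiteDimensional_of_finite
  have hinj : Function.Injective g := by
    refine (injective_iff_map_eq_zero g).2 fun u hu ↦ ?_
    by_contra hne
    exact (f.pos hne).ne' (by rw [hu, LinearMap.zero_apply])
  have hsurj : Function.Surjective g :=
    (LinearMap.injective_iff_surjective_of_finrank_eq_finrank
      (Subspace.dual_finrank_eq (K := ℝ) (V := L)).symm).1 hinj
  choose v hv using fun k ↦ hsurj (b.coord k)
  exact ⟨v, fun k W ↦ by rw [hv, Module.Basis.coord_apply]⟩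

theorem eq_sum (f : LieFrame h L g J x) (b : Module.Basis ι ℝ L) {v : ι → L}
    (hv : ∀ k W, g (v k) W = b.repr W k) {y : M} (hy : y ∈ f.dom)
    (u : TangentSpace 𝓘(ℝ, E) y) :
    u = ∑ k, h.metric.inner y (f.fld (v k) y) u • f.fld (b k) y := by
  obtain ⟨W, rfl⟩ := (f.bijective y hy).2 u
  calc f.fld W y = f.equivAt hy W := rfl
    _ = ∑ k, b.repr W k • f.equivAt hy (b k) := by
      conv_lhs => rw [← b.sum_repr W, map_sum]
      simp only [map_smul]
    _ = _ := Finset.sum_congr rfl fun k _ ↦ by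
      rw [← hv, ← f.metric _ _ y hy]
      rfl

theorem IsRegular.mdiffAt_deriv {f : LieFrame h L g J x} (b : Module.Basis ι ℝ L)
    {Z V : ∀ y : M, TangentSpace 𝓘(ℝ, E) y} (hZ : f.IsRegular D Z) (hV : MDiffAt (T% V) x) :
    MDiffAt (T% (fun y ↦ D Z y (V y))) x := by
  obtain ⟨v, hv⟩ := f.exists_dual b
  have hs : MDiffAt (T% (fun y ↦ ∑ k, ((fun y ↦ h.metric.inner y (f.fld (v k) y) (V y)) •
      fun y ↦ D Z y (f.fld (b k) y)) y)) x :=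
    .sum_section fun k _ ↦
      (mdiffAt_metric h (f.mdiffAt (v k) f.mem_dom) hV).smul_section (hZ.deriv (b k))
  refine mdiffAt_congr hs ?_
  filter_upwards [f.eventually_dom f.mem_dom] with y hy
  conv_lhs => rw [f.eq_sum b hv hy (V y)]
  rw [map_sum]
  exact Finset.sum_congr rfl fun k _ ↦ map_smul _ _ _

theorem curvatureOfFields_swap (X Y Z : ∀ y : M, TangentSpace 𝓘(ℝ, E) y) (y : M) :
    curvatureOfFields D X Y Z y = -curvatureOfFields D Y X Z y := by
  rw [curvatureOfFields, curvatureOfFields, mlieBracket_swap_apply, map_neg]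
  module

variable [FiniteDimensional ℝ E]

/-- Lets the arbitrary extensions in `curvatureAt` be replaced by frame fields in the first two
slots; the third slot is treated by expansion in the frame. -/
theorem IsRegular.tensorialAt_left {f : LieFrame h L g J x} (b : Module.Basis ι ℝ L)
    {Z Y : ∀ y : M, TangentSpace 𝓘(ℝ, E) y} (hZ : f.IsRegular D Z) :
    TensorialAt 𝓘(ℝ, E) E (fun X ↦ curvatureOfFields D X Y Z x) x where
  smul {φ X} hφ hX := by
    have h1 := D.isCovariantDerivativeOn.leibniz (hZ.mdiffAt_deriv b hX) hφ (Set.mem_univ x)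
    have h2 : (fun y ↦ D Z y ((φ • X) y)) = φ • fun y ↦ D Z y (X y) :=
      funext fun y ↦ map_smul _ _ _
    rw [curvatureOfFields, h2, h1, mlieBracket_smul_left hφ hX]
    simp [curvatureOfFields]
    module
  add {X X'} hX hX' := by
    have h1 := D.isCovariantDerivativeOn.add (hZ.mdiffAt_deriv b hX) (hZ.mdiffAt_deriv b hX')
      (Set.mem_univ x)
    have h2 : (fun y ↦ D Z y ((X + X') y)) = (fun y ↦ D Z y (X y)) + fun y ↦ D Z y (X' y) :=
      funext fun y ↦ map_add _ _ _
    rw [curvatureOfFields, h2, h1, mlieBracket_add_left hX hX']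
    simp [curvatureOfFields]
    module

theorem IsRegular.tensorialAt_right {f : LieFrame h L g J x} (b : Module.Basis ι ℝ L)
    {Z X : ∀ y : M, TangentSpace 𝓘(ℝ, E) y} (hZ : f.IsRegular D Z) :
    TensorialAt 𝓘(ℝ, E) E (fun Y ↦ curvatureOfFields D X Y Z x) x where
  smul hφ hY := by
    rw [curvatureOfFields_swap, (hZ.tensorialAt_left b).smul hφ hY, curvatureOfFields_swap X,
      smul_neg]
  add hY hY' := by
    rw [curvatureOfFields_swap, (hZ.tensorialAt_left b).add hY hY', curvatureOfFields_swap X,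
      curvatureOfFields_swap X, neg_add]

/-- The curvature of the Chern connection in the frame. -/
theorem curvatureAt_fld [Nontrivial L] [FiniteDimensional ℝ L] (f : LieFrame h L g J x)
    (hD : IsChernConnection h D) (X Y Z : L) :
    curvatureAt D x (f.fld X x) (f.fld Y x) (f.fld Z x) =
      f.fld (algCurvature (IsChernAlgebra.lieBilin L) (f.nab D) X Y Z) x := by
  let b := Module.finBasis ℝ L
  obtain ⟨v, hv⟩ := f.exists_dual b
  have hx := f.mem_dom
  let S := FiberBundle.extend E (f.fld Z x)
  let φ : Fin (Module.finrank ℝ L) → M → ℝ := fun k y ↦ h.metric.inner y (f.fld (v k) y) (S y)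
  have hφ : ∀ k, ContMDiffAt 𝓘(ℝ, E) 𝓘(ℝ, ℝ) 2 (φ k) x := fun k ↦
    contMDiffAt_metric (n := 2) h (f.contMDiffAt (v k) x hx) (FiberBundle.contMDiffAt_extend ..)
  have hS : S =ᶠ[𝓝 x] ∑ k, φ k • f.fld (b k) := by
    filter_upwards [f.eventually_dom hx] with y hy
    refine (f.eq_sum b hv hy (S y)).trans ?_
    exact (Finset.sum_apply y Finset.univ fun k ↦ φ k • f.fld (b k)).symm
  have hreg := f.isRegular_sum hD b hφ Finset.univ
  have hregS := hreg.congr hS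
  have h1 : curvatureAt D x (f.fld X x) (f.fld Y x) (f.fld Z x) =
      curvatureOfFields D (f.fld X) (f.fld Y) S x :=
    TensorialAt.pointwise₂ (Φ := fun X Y ↦ curvatureOfFields D X Y S x)
      (fun _ _ ↦ hregS.tensorialAt_left b) (fun _ _ ↦ hregS.tensorialAt_right b)
      (FiberBundle.mdifferentiableAt_extend ..) (f.mdiffAt X hx) (FiberBundle.mdifferentiableAt_extend ..)
      (f.mdiffAt Y hx) (by simp) (by simp)
  have hφx : ∀ k, φ k x = b.repr Z k := fun k ↦ by
    rw [← hv, ← f.metric _ _ x hx]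
    simp [φ, S]
  rw [h1, hreg.curvature_congr hS, f.curvature_sum hD b hφ]
  simp only [hφx]
  have hZ : algCurvature (IsChernAlgebra.lieBilin L) (f.nab D) X Y Z = ∑ k, b.repr Z k •
      algCurvature (IsChernAlgebra.lieBilin L) (f.nab D) X Y (b k) := by
    conv_lhs => rw [← b.sum_repr Z]
    simp only [algCurvature, map_sum, map_smul, smul_sub, Finset.sum_sub_distrib]
  rw [hZ, map_sum, Finset.sum_apply]
  simp only [map_smul, Pi.smul_apply]

end LieFrame

end

noncomputable section

/-! ### Complexification and the mixed curvature in real terms -/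

namespace IsChernAlgebra

variable {V : Type*} [AddCommGroup V] [Module ℝ V] {g : V →ₗ[ℝ] V →ₗ[ℝ] ℝ} {J : V →ₗ[ℝ] V}
  {br nab : V →ₗ[ℝ] V →ₗ[ℝ] V}

theorem algCurvature_swap (h : IsChernAlgebra g J br nab) (u v w : V) :
    algCurvature br nab u v w = -algCurvature br nab v u w := by
  rw [algCurvature, algCurvature, h.skew u v, map_neg, LinearMap.neg_apply]
  abel

theorem algCurvature_J (h : IsChernAlgebra g J br nab) (u v w : V) :
    algCurvature br nab u v (J w) = J (algCurvature br nab u v w) := by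
  simp only [algCurvature, h.parallel_J, map_sub]

theorem metric_algCurvature_swap (h : IsChernAlgebra g J br nab) (u v w z : V) :
    g (algCurvature br nab u v w) z = -g (algCurvature br nab u v z) w := by
  have h1 := h.metric u (nab v w) z
  have h2 := h.metric v w (nab u z)
  have h3 := h.metric v (nab u w) z
  have h4 := h.metric u w (nab v z)
  have h5 := h.metric (br u v) w z
  simp only [algCurvature, map_sub, LinearMap.sub_apply]
  rw [h.symm (nab u (nab v z)), h.symm (nab v (nab u z)), h.symm (nab (br u v) z)]
  linarith

theorem algCurvature_neg_left (u v w : V) :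
    algCurvature br nab (-u) v w = -algCurvature br nab u v w := by
  simp only [algCurvature, map_neg, LinearMap.neg_apply]
  abel

theorem algCurvature_neg_right (u v w : V) :
    algCurvature br nab u v (-w) = -algCurvature br nab u v w := by
  simp only [algCurvature, map_neg]
  abel

/-- Of the sixteen real terms only those with u and Ju in different slots survive antisymmetry.
Since R commutes with J and is skew, the nonzero ones agree up to sign, and four remain. -/
theorem complexExt₄_algCurvature (h : IsChernAlgebra g J br nab) (u z : V) :
    complexExt₄ (fun u v w z ↦ g (algCurvature br nab u v w) z) ![u, -J u] ![u, J u]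
      ![z, -J z] ![z, J z] = ((-4 * g (algCurvature br nab u (J u) z) (J z) : ℝ) : ℂ) := by
  have hself : ∀ v w : V, algCurvature br nab v v w = 0 := fun v w ↦ by
    have : (2 : ℝ) • algCurvature br nab v v w = 0 := by
      rw [two_smul]
      exact eq_neg_iff_add_eq_zero.1 (h.algCurvature_swap v v w)
    exact (smul_eq_zero.1 this).resolve_left two_ne_zero
  have hz : g (algCurvature br nab u (J u) z) z = 0 := by
    linarith [h.metric_algCurvature_swap u (J u) z z]
  simp only [complexExt₄, Fin.sum_univ_two, Matrix.cons_val_zero, Matrix.cons_val_one,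
    algCurvature_neg_left, algCurvature_neg_right, hself, h.algCurvature_swap (J u) u,
    h.algCurvature_J, h.metric_J, h.metric_J_left, hz, map_neg, map_zero, LinearMap.neg_apply,
    LinearMap.zero_apply, Fin.val_zero, Fin.val_one, neg_neg, neg_zero]
  push_cast
  ring_nf
  simp only [Complex.I_sq]
  ring

theorem complexExt₂_metric (h : IsChernAlgebra g J br nab) (u v : V) :
    complexExt₂ (fun u v ↦ g u v) ![u, -J u] ![v, J v]
      = ((2 * g u v : ℝ) : ℂ) + Complex.I * ((2 * g u (J v) : ℝ) : ℂ) := by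
  simp only [complexExt₂, Fin.sum_univ_two, Matrix.cons_val_zero, Matrix.cons_val_one,
    h.metric_J, h.metric_J_left, map_neg, LinearMap.neg_apply, Fin.val_zero, Fin.val_one, neg_neg]
  push_cast
  ring_nf
  simp only [Complex.I_sq]
  ring

end IsChernAlgebra

namespace LieFrame

variable {E : Type*} [NormedAddCommGroup E] [NormedSpace ℝ E]
  {M : Type*} [TopologicalSpace M] [ChartedSpace E M] [IsManifold 𝓘(ℝ, E) ∞ M]
  {h : HermitianStructure E M} {L : Type*} [LieRing L] [LieAlgebra ℝ L]
  {g : L →ₗ[ℝ] L →ₗ[ℝ] ℝ} {J : L →ₗ[ℝ] L} {x : M}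
  {D : CovariantDerivative 𝓘(ℝ, E) E (fun x : M ↦ TangentSpace 𝓘(ℝ, E) x)}

/-- The vector `u - √-1 J u` of type `(1,0)` at `x`. -/
def hol (f : LieFrame h L g J x) (u : L) : Fin 2 → TangentSpace 𝓘(ℝ, E) x :=
  fun a ↦ f.fld (![u, -J u] a) x

theorem complexConj_hol (f : LieFrame h L g J x) (u : L) :
    complexConj (f.hol u) = fun a ↦ f.fld (![u, J u] a) x := by
  funext a
  fin_cases a
  · rfl
  · change -f.fld (-J u) x = f.fld (J u) x
    rw [map_neg, Pi.neg_apply, neg_neg]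

theorem isType10_hol (f : LieFrame h L g J x) (u : L) : h.IsType10 x (f.hol u) := by
  change f.fld (-J u) x = -h.J x (f.fld u x)
  rw [f.J_fld _ x f.mem_dom, map_neg, Pi.neg_apply]

variable [FiniteDimensional ℝ E]

theorem metricC_hol (f : LieFrame h L g J x) (hD : IsChernConnection h D) (u v : L) :
    h.metricC x (f.hol u) (complexConj (f.hol v))
      = ((2 * g u v : ℝ) : ℂ) + Complex.I * ((2 * g u (J v) : ℝ) : ℂ) := by
  rw [← (f.isChernAlgebra hD f.mem_dom).complexExt₂_metric, complexConj_hol]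
  simp only [HermitianStructure.metricC, complexExt₂, hol, f.metric _ _ x f.mem_dom]

theorem curvatureC_hol [Nontrivial L] [FiniteDimensional ℝ L] (f : LieFrame h L g J x)
    (hD : IsChernConnection h D) (u z : L) :
    h.curvatureC D x (f.hol u) (complexConj (f.hol u)) (f.hol z) (complexConj (f.hol z)) =
      ((-4 * g (algCurvature (IsChernAlgebra.lieBilin L) (f.nab D) u (J u) z) (J z) : ℝ) : ℂ) := by
  have hA : IsChernAlgebra g J (IsChernAlgebra.lieBilin L) (f.nab D) :=
    f.isChernAlgebra hD f.mem_dom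
  rw [← hA.complexExt₄_algCurvature, complexConj_hol, complexConj_hol]
  simp only [HermitianStructure.curvatureC, complexExt₄, hol, f.curvatureAt_fld hD,
    f.metric _ _ x f.mem_dom]

theorem mixed_curvature [Nontrivial L] [FiniteDimensional ℝ L] (f : LieFrame h L g J x)
    (hD : IsChernConnection h D) {α β c : ℝ} (hc : h.HasConstantMixedCurvature D α β c)
    {n : ℕ} {e : Fin n → L} (hn : Module.finrank ℝ L = 2 * n)
    (he : ∀ i j, g (e i) (e j) = if i = j then 1 / 2 else 0) (heJ : ∀ i j, g (e i) (J (e j)) = 0)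
    {u : L} (hu : g u u = 1 / 2) :
    α * ∑ i, -4 * g (algCurvature (IsChernAlgebra.lieBilin L) (f.nab D) u (J u) (e i)) (J (e i))
      + β * (-4 * g (algCurvature (IsChernAlgebra.lieBilin L) (f.nab D) u (J u) u) (J u)) = c := by
  have hA := f.isChernAlgebra hD f.mem_dom
  have hframe : h.IsUnitaryFrame x fun i ↦ f.hol (e i) := by
    refine ⟨(f.equivAt f.mem_dom).finrank_eq.symm.trans hn, fun i ↦ f.isType10_hol _,
      fun i j ↦ ?_⟩
    rw [f.metricC_hol hD, he, heJ]
    split_ifs <;> simp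
  have huJ : g u (J u) = 0 := by
    linarith [hA.metric_J_left u u, hA.symm (J u) u]
  have hunit : h.metricC x (f.hol u) (complexConj (f.hol u)) = 1 := by
    rw [f.metricC_hol hD, hu, huJ]
    simp
  have key := hc x n _ hframe _ (f.isType10_hol u) hunit
  rw [HermitianStructure.ricci, HermitianStructure.holomorphicSectional, hunit,
    f.curvatureC_hol hD] at key
  simp only [f.curvatureC_hol hD, one_pow, div_one] at key
  exact_mod_cast key

end LieFrame

theorem HermitianStructure.lieJ_mem_commutatorHull
    {E : Type*} [NormedAddCommGroup E] [NormedSpace ℝ E] [FiniteDimensional ℝ E]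
    {G : Type*} [TopologicalSpace G] [ChartedSpace E G] [Group G] [LieGroup 𝓘(ℝ, E) ∞ G]
    (h : HermitianStructure E G) (x : GroupLieAlgebra 𝓘(ℝ, E) G) (hx : x ∈ h.commutatorHull) :
    h.lieJ x ∈ h.commutatorHull := by
  obtain ⟨y, hy, _, ⟨z, hz, rfl⟩, rfl⟩ := Submodule.mem_sup.1 hx
  rw [map_add, add_comm]
  refine Submodule.add_mem_sup ?_ (Submodule.mem_map_of_mem hy)
  have : h.lieJ ((h.J 1 : GroupLieAlgebra 𝓘(ℝ, E) G →ₗ[ℝ] GroupLieAlgebra 𝓘(ℝ, E) G) z) = -z :=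
    h.J_J 1 z
  rw [this]
  exact Submodule.neg_mem _ hz

theorem HermitianStructure.lie_mem_commutatorHull
    {E : Type*} [NormedAddCommGroup E] [NormedSpace ℝ E] [FiniteDimensional ℝ E]
    {G : Type*} [TopologicalSpace G] [ChartedSpace E G] [Group G] [LieGroup 𝓘(ℝ, E) ∞ G]
    (h : HermitianStructure E G) (x y : GroupLieAlgebra 𝓘(ℝ, E) G) :
    ⁅x, y⁆ ∈ h.commutatorHull := by
  refine Submodule.mem_sup_left ?_
  simp only [LieAlgebra.derivedSeriesOfIdeal_succ, LieAlgebra.derivedSeriesOfIdeal_zero]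
  exact LieSubmodule.lie_mem_lie (LieSubmodule.mem_top x) (LieSubmodule.mem_top y)

end

/-! ### The theorem -/

theorem mainTheorem2
    {E : Type*} [NormedAddCommGroup E] [NormedSpace ℝ E] [FiniteDimensional ℝ E] [Nontrivial E]
    {G : Type*} [TopologicalSpace G] [ChartedSpace E G] [Group G] [LieGroup 𝓘(ℝ, E) ∞ G]
    {M : Type*} [TopologicalSpace M] [ChartedSpace E M] [IsManifold 𝓘(ℝ, E) ∞ M]
    (hG : HermitianStructure E G) (Γ : Subgroup G) (hM : HermitianStructure E M) (p : G → M)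
    (hLH : IsLieHermitian hG Γ hM p)
    (hnil : LieRing.IsNilpotent hG.commutatorHull)
    (D : CovariantDerivative 𝓘(ℝ, E) E (fun x : M ↦ TangentSpace 𝓘(ℝ, E) x))
    (hD : IsChernConnection hM D)
    (α β : ℝ) (hαβ : (α, β) ≠ (0, 0)) :
    (∀ c : ℝ, hM.HasConstantMixedCurvature D α β c → c = 0) ∧
      (hM.HasConstantMixedCurvature D α β 0 → β ≠ 0 → IsFlatConnection D) := by
  have : FiniteDimensional ℝ (GroupLieAlgebra 𝓘(ℝ, E) G) := inferInstanceAs (FiniteDimensional ℝ E)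
  have : Nontrivial (GroupLieAlgebra 𝓘(ℝ, E) G) := inferInstanceAs (Nontrivial E)
  have key : ∀ (x : M) (f : LieFrame hM (GroupLieAlgebra 𝓘(ℝ, E) G) hG.lieMetric hG.lieJ x)
      (c : ℝ), hM.HasConstantMixedCurvature D α β c → c = 0 ∧ (β ≠ 0 → ∀ u v w,
        algCurvature (IsChernAlgebra.lieBilin _) (f.nab D) u v w = 0) := fun x f c hc ↦
    (f.isChernAlgebra hD f.mem_dom).mixed_curvature hG.lieJ_mem_commutatorHull
      hG.lie_mem_commutatorHull hnil fun n e hn he heJ u hu ↦ f.mixed_curvature hD hc hn he heJ hu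
  refine ⟨fun c hc ↦ ?_, fun hc hβ x u v w ↦ ?_⟩
  · obtain ⟨f⟩ := exists_lieFrame hLH (p 1)
    exact (key _ f c hc).1
  · obtain ⟨f⟩ := exists_lieFrame hLH x
    obtain ⟨X, rfl⟩ := (f.bijective x f.mem_dom).2 u
    obtain ⟨Y, rfl⟩ := (f.bijective x f.mem_dom).2 v
    obtain ⟨Z, rfl⟩ := (f.bijective x f.mem_dom).2 w
    rw [f.curvatureAt_fld hD, (key x f 0 hc).2 hβ, map_zero, Pi.zero_apply]
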